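/- Let $b>0$ and consider the $b$-Novikov equation $$u_t-u_{xxt}=b\,u\,u_x u_{xx}-(b+1)u^2u_x+u^2u_{xxx},\qquad x\in\mathbb R,\ t>0. \tag{1}$$ Fix $d>0$. There are a continuous function $\alpha:(0,\infty)\to(0,\infty)$ and real-valued functions $w(z;a,d,k)$ and $c(a,d,k)$, defined for $z\in\mathbb R$, $k>0$ and $|a|<\alpha(k)$, with the following properties. The function $c$ is real analytic in $(k,a)$ and even in $a$; the function $w$ is real analytic in $(k,a)$, indeed jointly in $(k,a,z)$. For all $k>0$ and $|a|<\alpha(k)$, the function $z\mapsto w(z;a,d,k)$ is smooth, $2\pi$-periodic and even, and $$c>0,\qquad w^2<c,\qquad w-k^2w''>0,\qquad (w-k^2w'')\,(c-w^2)^{b/2}=d\qquad\text{for all } z\in\mathbb R$$ (so $d$ is the constant of integration of the travelling-wave equation), and $$u(x,t)=w\bigl(k(x-c(a,d,k)t);a,d,k\bigr)$$ is a smooth solution of (1), $2\pi/k$-periodic in $x$. Moreover, for each $k>0$, as $a\to0$, $$w(z;a,d,k)=w_0+a\cos z+a^2\,(e_1+e_2\cos 2z)+O(a^3)\quad\text{uniformly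 in } z,\qquad c(a,d,k)=c_0+a^2c_2+O(a^4),$$ where the implied constants may depend on $b$, $d$ and $k$, and $$w_0=d^{\frac1{b+1}}\Bigl(\frac b{1+k^2}\Bigr)^{-\frac b{2(b+1)}},\qquad c_0=\frac{k^2+b+1}{k^2+1}\,w_0^2=d^{\frac2{b+1}}\Bigl(\frac b{1+k^2}\Bigr)^{-\frac b{b+1}}\frac{k^2+b+1}{k^2+1},$$ $$e_1=\frac{\bigl[-2(1+k^2)^2+(-4-6k^2+k^4)b+(-2-2k^2+k^4)b^2\bigr]\bigl(\frac b{1+k^2}\bigr)^{-\frac{2+b}{2(1+b)}}}{24(1+b)\,d^{\frac1{1+b}}\,k^2},$$ $$e_2=\frac{\bigl[(2+2b)+(4+3b)k^2+(2+b)k^4\bigr]\bigl(\frac b{1+k^2}\bigr)^{\frac b{2(1+b)}}}{12\,b\,d^{\frac1{1+b}}\,k^2},$$ $$c_2=\frac{(10+8k^2-2k^4)+(20+12k^2+k^4)b+(10+4k^2+k^4)b^2}{12\,b\,(1+b)}.$$ -/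

import Mathlib

open scoped ContDiff Topology

noncomputable section

namespace BNovikov

/-- `u = u(x,t)` is a (smooth, classical) solution of the `b`-Novikov equation
`u_t - u_xxt = b u u_x u_xx - (b+1) u² u_x + u² u_xxx` for `x ∈ ℝ`, `t > 0`. -/
structure IsSolution (b : ℝ) (u : ℝ → ℝ → ℝ) : Prop where
  smooth : ContDiffOn ℝ ∞ (fun p : ℝ × ℝ => u p.1 p.2) {p | 0 < p.2}
  equation : ∀ x t : ℝ, 0 < t →
    deriv (fun s => u x s) t - deriv (fun s => iteratedDeriv 2 (fun y => u y s) x) t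
      = b * u x t * deriv (fun y => u y t) x * iteratedDeriv 2 (fun y => u y t) x
        - (b + 1) * u x t ^ 2 * deriv (fun y => u y t) x
        + u x t ^ 2 * iteratedDeriv 3 (fun y => u y t) x

/-- The constant `w₀(k,d)`. -/
def w0 (b d k : ℝ) : ℝ :=
  d ^ (1 / (b + 1)) * (b / (1 + k ^ 2)) ^ (-b / (2 * (b + 1)))

/-- The bifurcation speed `c₀(k,d) = (k² + b + 1)/(k² + 1) · w₀²`. -/
def c0 (b d k : ℝ) : ℝ :=
  (k ^ 2 + b + 1) / (k ^ 2 + 1) * w0 b d k ^ 2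

/-- The coefficient `e₁`. -/
def e1 (b d k : ℝ) : ℝ :=
  (-2 * (1 + k ^ 2) ^ 2 + (-4 - 6 * k ^ 2 + k ^ 4) * b + (-2 - 2 * k ^ 2 + k ^ 4) * b ^ 2)
      * (b / (1 + k ^ 2)) ^ (-(2 + b) / (2 * (1 + b)))
    / (24 * (1 + b) * d ^ (1 / (1 + b)) * k ^ 2)

/-- The coefficient `e₂`. -/
def e2 (b d k : ℝ) : ℝ :=
  ((2 + 2 * b) + (4 + 3 * b) * k ^ 2 + (2 + b) * k ^ 4)
      * (b / (1 + k ^ 2)) ^ (b / (2 * (1 + b)))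
    / (12 * b * d ^ (1 / (1 + b)) * k ^ 2)

/-- The coefficient `c₂`. -/
def c2 (b k : ℝ) : ℝ :=
  ((10 + 8 * k ^ 2 - 2 * k ^ 4) + (20 + 12 * k ^ 2 + k ^ 4) * b + (10 + 4 * k ^ 2 + k ^ 4) * b ^ 2)
    / (12 * b * (1 + b))

end BNovikov

end

/-!
The travelling-wave equation, integrated once, is `w - k² w'' = d (c - w²) ^ (-b/2)`. It is a
conservative planar system, so the periodic waves can be written down in action-angle variables and
no bifurcation theory in function spaces is needed.

Instead of the speed, the linear frequency `m` at the equilibrium is the parameter: the equilibrium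
with frequency `m` is `w₀(m)` and has speed `c₀(m)`. Writing `w = w₀(m) (1 + s)`, the equation
becomes `k² s'' = -force b (s, m)` with `∂ₛ force b (0, m) = m²`. In the coordinate `q` with
`∫₀ˢ force = m² q² / 2` (`exists_normalForm`, where `s = S (q, m)`), the orbits are the circles
`q = r cos θ` and `k θ' ∂_q S = m`. Hence the phase is `z = (k / m) ∫₀^θ ∂_q S (r cos ϑ, m) dϑ`,
and the orbit has period `2π` in `z` exactly when `k ∫₀¹ ∂_q S (r cos 2πt, m) dt = m`. At `r = 0`
this reads `m = k`, and the implicit function theorem gives `m = M (r, k)`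
(`nonempty_actionAngle`). Evenness in `r` comes from the shift `θ ↦ θ + π`, and periodicity and
evenness in `z` are visible from the phase, which is odd in `θ` and commutes with the shift by `2π`.
The amplitude of the statement is `a = r w₀(k)`.

All objects arise from explicit functions by integration over compact intervals
(`analyticAt_intervalIntegral`) and by scalar implicit functions, so they are analytic in all
variables jointly. Uniqueness of implicit functions and the identity theorem glue the local
solutions near each `k > 0` to one function on a tube around the half axis `r = 0`
(`exists_implicit_along_axis`), whose radius can be taken continuous because the distance to the
complement of an open set is.

The expansions come from the Taylor coefficients `β` and `γ` of `S (·, m)`, which the energy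
relation `m² q = force (S) ∂_q S` determines. Averaging over the angle gives
`M = k + k γ r² / 4 + O(r³)` (`ActionAngle.M_sub_isBigO`), and this yields the speed. Inverting the
phase to second order gives `cos θ = cos z + β r sin² z + O(r²)` uniformly in `z`
(`ActionAngle.cos_angle_isBigO`), and this yields the profile.
-/

noncomputable section
namespace BNovikov
open Set Filter Metric

attribute [local fun_prop] analyticAt_fst analyticAt_snd

/-! ### Analyticity of parametric integrals -/

section Integral
open FormalMultilinearSeries
open scoped NNReal ENNReal

variable {E : Type*} [NormedAddCommGroup E] [NormedSpace ℝ E]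

/-- The integral over a short interval around `t₀`: the power series of `f` at `(x₀, t₀)` is
re-centred at `(x₀, t)`, restricted to the first factor, and integrated in `t` term by term. -/
theorem exists_analyticAt_intervalIntegral_of_near {f : E × ℝ → ℝ} {x₀ : E} {t₀ : ℝ}
    (hf : AnalyticAt ℝ f (x₀, t₀)) :
    ∃ ε > 0, ∀ u v : ℝ, t₀ - ε < u → u ≤ v → v < t₀ + ε →
      AnalyticAt ℝ (fun x => ∫ t in u..v, f (x, t)) x₀ := by
  obtain ⟨p, R, hp⟩ := hf
  obtain ⟨r, hr0, hrR⟩ : ∃ r : ℝ≥0, 0 < r ∧ ((r : ℝ≥0∞) + r) < R := by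
    obtain ⟨s, hs0, hs⟩ := ENNReal.lt_iff_exists_nnreal_btwn.1 hp.r_pos
    have hs0' : 0 < s := by exact_mod_cast hs0
    refine ⟨s / 2, by positivity, ?_⟩
    rw [← ENNReal.coe_add, add_halves]; exact hs
  have hrad : ((r : ℝ≥0∞) + r) < p.radius := hrR.trans_le hp.r_le
  have hsum := p.changeOriginSeries_summable_aux₁ hrad
  set S : ℝ≥0 := ∑' s : Σ k l : ℕ, { s : Finset (Fin (k + l)) // s.card = l },
    ‖p (s.1 + s.2.1)‖₊ * r ^ s.2.1 * r ^ s.1 with hS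
  have hrR' : (r : ℝ≥0∞) < p.radius := lt_of_le_of_lt (by simp) hrad
  -- the re-centred coefficients obey one geometric bound for all nearby centres
  have hbound : ∀ y : E × ℝ, ‖y‖₊ ≤ r → ∀ n, ‖p.changeOrigin y n‖₊ * r ^ n ≤ S := by
    intro y hy n
    have hy' : (‖y‖₊ : ℝ≥0∞) < p.radius := lt_of_le_of_lt (by exact_mod_cast hy) hrR'
    have hS2 := (NNReal.summable_sigma.1 hsum)
    calc ‖p.changeOrigin y n‖₊ * r ^ n
        ≤ (∑' s : Σ l : ℕ, { s : Finset (Fin (n + l)) // s.card = l },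
            ‖p (n + s.1)‖₊ * r ^ s.1) * r ^ n := by
          gcongr
          refine (p.nnnorm_changeOrigin_le n hy').trans ?_
          refine Summable.tsum_le_tsum (fun s => by gcongr)
            (p.changeOriginSeries_summable_aux₂ hy' n) (p.changeOriginSeries_summable_aux₂ hrR' n)
      _ = ∑' s : Σ l : ℕ, { s : Finset (Fin (n + l)) // s.card = l },
            ‖p (n + s.1)‖₊ * r ^ s.1 * r ^ n := by rw [NNReal.tsum_mul_right]
      _ ≤ S := by
          rw [hS, hsum.tsum_sigma' (fun b => hS2.1 b)]
          exact hS2.2.le_tsum n (fun _ _ => zero_le)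
  refine ⟨r, by exact_mod_cast hr0, fun u v hu huv hv => ?_⟩
  let P : ∀ n : ℕ, ℝ → ContinuousMultilinearMap ℝ (fun _ : Fin n => E) ℝ := fun n t =>
    (p.changeOrigin ((0 : E), t - t₀) n).compContinuousLinearMap
      (fun _ => ContinuousLinearMap.inl ℝ E ℝ)
  have hy : ∀ t ∈ Icc u v, ‖((0 : E), t - t₀)‖₊ < r := by
    intro t ht
    rw [← NNReal.coe_lt_coe, coe_nnnorm]
    simp only [Prod.norm_def, norm_zero, Real.norm_eq_abs]
    rw [max_eq_right (abs_nonneg _), abs_lt]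
    constructor <;> linarith [ht.1, ht.2]
  have hPb : ∀ n, ∀ t ∈ Icc u v, ‖P n t‖ * (r : ℝ) ^ n ≤ S := by
    intro n t ht
    have h1 := hbound _ (hy t ht).le n
    have h2 : ‖P n t‖ ≤ ‖p.changeOrigin ((0 : E), t - t₀) n‖ := by
      refine (ContinuousMultilinearMap.norm_compContinuousLinearMap_le _ _).trans ?_
      have : ∏ _i : Fin n, ‖ContinuousLinearMap.inl ℝ E ℝ‖ ≤ 1 :=
        Finset.prod_le_one (fun _ _ => norm_nonneg _)
          (fun _ _ => ContinuousLinearMap.norm_inl_le_one ℝ E ℝ)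
      nlinarith [norm_nonneg (p.changeOrigin ((0 : E), t - t₀) n)]
    have h3 : ‖p.changeOrigin ((0 : E), t - t₀) n‖ * (r : ℝ) ^ n ≤ S := by exact_mod_cast h1
    exact (mul_le_mul_of_nonneg_right h2 (by positivity)).trans h3
  have hPc : ∀ n, ContinuousOn (P n) (Icc u v) := by
    intro n
    have h1 : ContinuousOn (fun y => p.changeOrigin y n) (eball 0 p.radius) :=
      (p.hasFPowerSeriesOnBall_changeOrigin n (lt_of_le_of_lt zero_le hrR')).continuousOn
    have h2 : ContinuousOn (fun t : ℝ => p.changeOrigin ((0 : E), t - t₀) n) (Icc u v) := by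
      refine h1.comp (by fun_prop) (fun t ht => ?_)
      rw [mem_eball_zero_iff]
      refine lt_trans ?_ hrR'
      have := hy t ht
      exact_mod_cast this
    exact ((ContinuousMultilinearMap.compContinuousLinearMapL
      (fun _ : Fin n => ContinuousLinearMap.inl ℝ E ℝ)).continuous.comp_continuousOn h2)
  have hPi : ∀ n, IntervalIntegrable (P n) MeasureTheory.volume u v := fun n =>
    ContinuousOn.intervalIntegrable_of_Icc huv (hPc n)
  have hPs : ∀ t ∈ Icc u v, ∀ h : E, ‖h‖₊ < r →
      HasSum (fun n => P n t (fun _ => h)) (f (x₀ + h, t)) := by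
    intro t ht h hh
    have hty : (‖((0 : E), t - t₀)‖₊ : ℝ≥0∞) < r := by exact_mod_cast hy t ht
    have hr1 : (r : ℝ≥0∞) < R := lt_of_le_of_lt (by simp) hrR
    have h1 := hp.changeOrigin (y := ((0 : E), t - t₀)) (hty.trans hr1)
    have h2 := h1.hasSum (y := (h, (0 : ℝ))) (by
      rw [mem_eball_zero_iff, lt_tsub_iff_right]
      refine lt_of_le_of_lt ?_ hrR
      gcongr
      · simp only [enorm, Prod.nnnorm_def, nnnorm_zero]
        simpa using hh.le)
    simpa [P, ContinuousMultilinearMap.compContinuousLinearMap_apply, Prod.mk_add_mk] using h2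
  let Q : FormalMultilinearSeries ℝ E ℝ := fun n => ∫ t in u..v, P n t
  have hQ : (r : ℝ≥0∞) ≤ Q.radius := by
    refine Q.le_radius_of_bound (S * |v - u|) (fun n => ?_)
    have h1 : ‖Q n‖ ≤ (S / (r : ℝ) ^ n) * |v - u| := by
      refine intervalIntegral.norm_integral_le_of_norm_le_const (fun t ht => ?_)
      rw [uIoc_of_le huv] at ht
      rw [le_div_iff₀ (by positivity)]
      exact hPb n t ⟨ht.1.le, ht.2⟩
    calc ‖Q n‖ * (r : ℝ) ^ n ≤ (S / (r : ℝ) ^ n) * |v - u| * (r : ℝ) ^ n := by gcongr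
      _ = S * |v - u| := by
        have : (r : ℝ) ^ n ≠ 0 := by positivity
        field_simp
  refine HasFPowerSeriesOnBall.analyticAt (p := Q) (r := r) ⟨hQ, by exact_mod_cast hr0, ?_⟩
  intro h hh
  have hh' : ‖h‖₊ < r := by
    rw [mem_eball_zero_iff] at hh
    exact_mod_cast hh
  have hQa : ∀ n, Q n (fun _ => h) = ∫ t in u..v, P n t (fun _ => h) := fun n =>
    ((ContinuousMultilinearMap.apply ℝ (fun _ : Fin n => E) ℝ
      (fun _ => h)).intervalIntegral_comp_comm (hPi n)).symm
  simp only [hQa]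
  have hr0' : (0 : ℝ) < r := by exact_mod_cast hr0
  have hq : ‖h‖ / r < 1 := by
    rw [div_lt_one hr0']; exact_mod_cast hh'
  have hgeo : Summable fun n : ℕ => (S : ℝ) * (‖h‖ / r) ^ n :=
    (summable_geometric_of_lt_one (by positivity) hq).mul_left _
  refine intervalIntegral.hasSum_integral_of_dominated_convergence
    (fun n _ => (S : ℝ) * (‖h‖ / r) ^ n) (fun n => ?_) (fun n => ?_) ?_ ?_ ?_
  · rw [uIoc_of_le huv]
    refine ContinuousOn.aestronglyMeasurable ?_ measurableSet_Ioc
    exact ((ContinuousMultilinearMap.apply ℝ (fun _ : Fin n => E) ℝ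
      (fun _ => h)).continuous.comp_continuousOn (hPc n)).mono Ioc_subset_Icc_self
  · refine Eventually.of_forall (fun t ht => ?_)
    rw [uIoc_of_le huv] at ht
    have h1 := hPb n t ⟨ht.1.le, ht.2⟩
    have h2 : ‖P n t (fun _ => h)‖ ≤ ‖P n t‖ * ‖h‖ ^ n := by
      simpa using (P n t).le_opNorm (fun _ => h)
    refine h2.trans ?_
    rw [div_pow, ← mul_div_assoc, le_div_iff₀ (by positivity)]
    calc ‖P n t‖ * ‖h‖ ^ n * (r : ℝ) ^ n = (‖P n t‖ * (r : ℝ) ^ n) * ‖h‖ ^ n := by ring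
      _ ≤ S * ‖h‖ ^ n := by gcongr
  · exact Eventually.of_forall (fun _ _ => hgeo)
  · exact intervalIntegrable_const
  · refine Eventually.of_forall (fun t ht => ?_)
    rw [uIoc_of_le huv] at ht
    exact hPs t ⟨ht.1.le, ht.2⟩ h hh'

theorem eventually_continuousOn_of_analyticAt {f : E × ℝ → ℝ} {x₀ : E} {a b : ℝ}
    (hf : ∀ t ∈ Icc a b, AnalyticAt ℝ f (x₀, t)) :
    ∀ᶠ x in 𝓝 x₀, ContinuousOn (fun t => f (x, t)) (Icc a b) := by
  have h : ∀ᶠ x in 𝓝 x₀, ∀ t ∈ Icc a b, AnalyticAt ℝ f (x, t) :=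
    isCompact_Icc.eventually_forall_of_forall_eventually
      (P := fun x t => AnalyticAt ℝ f (x, t)) (fun t ht => (hf t ht).eventually_analyticAt)
  filter_upwards [h] with x hx t ht
  exact ((hx t ht).continuousAt.comp (f := fun t => (x, t)) (by fun_prop)).continuousWithinAt

/-- A parametric integral over a compact interval is real analytic when the integrand is jointly
analytic; the interval is cut into pieces short enough for a single power series each. -/
theorem analyticAt_intervalIntegral {f : E × ℝ → ℝ} {x₀ : E} {a b : ℝ} (hab : a ≤ b)
    (hf : ∀ t ∈ Icc a b, AnalyticAt ℝ f (x₀, t)) :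
    AnalyticAt ℝ (fun x => ∫ t in a..b, f (x, t)) x₀ := by
  choose ε hε hε' using fun t : Icc a b => exists_analyticAt_intervalIntegral_of_near (hf t t.2)
  obtain ⟨T, hT0, hTm, ⟨N, hN⟩, hT⟩ := exists_monotone_Icc_subset_open_cover_Icc hab
    (c := fun s : Icc a b => Subtype.val ⁻¹' Ioo ((s : ℝ) - ε s) (s + ε s))
    (fun s => isOpen_Ioo.preimage continuous_subtype_val)
    (fun t _ => mem_iUnion.2 ⟨t, by simp [hε t]⟩)
  have hcont := eventually_continuousOn_of_analyticAt hf
  have key : ∀ n, AnalyticAt ℝ (fun x => ∫ t in a..(T n : ℝ), f (x, t)) x₀ := by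
    intro n
    induction n with
    | zero => simp [hT0, analyticAt_const]
    | succ n ih =>
      obtain ⟨s, hs⟩ := hT n
      have hle : T n ≤ T (n + 1) := hTm (Nat.le_succ n)
      have h1 := hs ⟨le_rfl, hle⟩
      have h2 := hs ⟨hle, le_rfl⟩
      have h3 := hε' s (T n) (T (n + 1)) h1.1 hle h2.2
      refine (ih.add h3).congr ?_
      filter_upwards [hcont] with x hx
      refine intervalIntegral.integral_add_adjacent_intervals ?_ ?_
      · exact ContinuousOn.intervalIntegrable_of_Icc (T n).2.1
          (hx.mono (Icc_subset_Icc le_rfl (T n).2.2))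
      · exact ContinuousOn.intervalIntegrable_of_Icc hle
          (hx.mono (Icc_subset_Icc (T n).2.1 (T (n + 1)).2.2))
  simpa [hN N le_rfl] using key N

end Integral

/-! ### Implicit functions along a half axis -/

section Implicit
variable {E : Type*} [NormedAddCommGroup E] [NormedSpace ℝ E] [CompleteSpace E]

/-- Real analytic implicit function theorem for one scalar equation in one scalar unknown, with
local uniqueness of the solution. -/
theorem exists_analyticAt_implicit {G : E × ℝ → ℝ} {x₀ : E} {t₀ c : ℝ}
    (hG : AnalyticAt ℝ G (x₀, t₀)) (hc : HasDerivAt (fun t => G (x₀, t)) c t₀) (hc0 : c ≠ 0) :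
    ∃ g : E → ℝ, AnalyticAt ℝ g x₀ ∧ g x₀ = t₀ ∧ (∀ᶠ x in 𝓝 x₀, G (x, g x) = G (x₀, t₀)) ∧
      ∀ᶠ p in 𝓝 (x₀, t₀), G p = G (x₀, t₀) → p.2 = g p.1 := by
  have cdf : ContDiffAt ℝ ω G (x₀, t₀) := hG.contDiffAt
  have hd : HasFDerivAt G (fderiv ℝ G (x₀, t₀)) (x₀, t₀) := hG.differentiableAt.hasFDerivAt
  have h1 : (fderiv ℝ G (x₀, t₀)) (0, 1) = c := by
    have h2 : HasDerivAt (fun t : ℝ => (x₀, t)) ((0 : E), (1 : ℝ)) t₀ :=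
      (hasDerivAt_const t₀ x₀).prodMk (hasDerivAt_id t₀)
    exact (hd.comp_hasDerivAt t₀ h2).unique hc
  have hinv : (fderiv ℝ G (x₀, t₀) ∘L .inr ℝ E ℝ).IsInvertible := by
    refine ⟨ContinuousLinearEquiv.unitsEquivAut ℝ (Units.mk0 c hc0), ?_⟩
    ext
    simp [h1]
  refine ⟨cdf.implicitFunction (by simp) hinv, ?_, ?_, ?_, ?_⟩
  · exact (cdf.contDiffAt_implicitFunction (by simp) hinv).analyticAt
  · exact cdf.implicitFunction_apply_self (by simp) hinv
  · exact cdf.eventually_apply_implicitFunction (by simp) hinv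
  · filter_upwards [cdf.eventually_apply_eq_iff_implicitFunction (by simp) hinv] with p hp h
    exact (hp.1 h).symm

end Implicit

section Axis

/-- The tubular neighbourhood of variable radius `α k` around the half axis `{(0, k) : k > 0}`. -/
def tube (α : ℝ → ℝ) : Set (ℝ × ℝ) := {p | 0 < p.2 ∧ |p.1| < α p.2}

theorem isOpen_tube {α : ℝ → ℝ} (hα : ContinuousOn α (Ioi 0)) : IsOpen (tube α) := by
  have h : tube α = {p : ℝ × ℝ | p.2 ∈ Ioi 0} ∩ (fun p : ℝ × ℝ => α p.2 - |p.1|) ⁻¹' Ioi 0 := by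
    ext p; simp [tube]
  rw [h]
  refine ContinuousOn.isOpen_inter_preimage ?_ (isOpen_Ioi.preimage continuous_snd) isOpen_Ioi
  exact (hα.comp continuous_snd.continuousOn (fun p hp => hp)).sub
    (continuous_abs.comp continuous_fst).continuousOn

/-- An open set containing the half axis `{(0, k) : k > 0}` contains a tube of continuous radius;
the radius is the distance to the complement. -/
theorem exists_tube_subset {U : Set (ℝ × ℝ)} (hU : IsOpen U) (h0 : ∀ k : ℝ, 0 < k → (0, k) ∈ U) :
    ∃ α : ℝ → ℝ, ContinuousOn α (Ioi 0) ∧ (∀ k, 0 < k → 0 < α k) ∧ tube α ⊆ U := by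
  -- removing `k ≤ 0` makes the complement nonempty, so that `infDist` is not a junk value
  set V : Set (ℝ × ℝ) := U ∩ {p | 0 < p.2} with hV
  have hVo : IsOpen V := hU.inter (isOpen_lt continuous_const continuous_snd)
  have hne : (Vᶜ).Nonempty := ⟨(0, 0), by simp [hV]⟩
  refine ⟨fun k => infDist ((0 : ℝ), k) Vᶜ, ?_, fun k hk => ?_, fun p hp => ?_⟩
  · exact ((continuous_infDist_pt _).comp (by fun_prop)).continuousOn
  · rw [← hVo.isClosed_compl.notMem_iff_infDist_pos hne]
    exact fun h => h ⟨h0 k hk, hk⟩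
  · by_contra hpU
    have h1 : infDist ((0 : ℝ), p.2) Vᶜ ≤ dist ((0 : ℝ), p.2) p :=
      infDist_le_dist_of_mem (fun h => hpU h.1)
    have h2 : dist ((0 : ℝ), p.2) p = |p.1| := by
      simp [Prod.dist_eq, Real.dist_eq]
    rw [h2] at h1
    exact absurd hp.2 (not_lt.2 h1)

/-- Analytic functions on balls centred on the half axis, with the same germs at the axis points
common to two balls, are restrictions of a single function on the union of the balls. -/
theorem exists_analyticOnNhd_glue {F : ℝ → ℝ × ℝ → ℝ} {ε : ℝ → ℝ}
    (hε : ∀ κ, 0 < κ → 0 < ε κ)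
    (hF : ∀ κ, 0 < κ → AnalyticOnNhd ℝ (F κ) (ball (0, κ) (ε κ)))
    (hc : ∀ κ κ' k, 0 < κ → 0 < κ' → (0, k) ∈ ball ((0 : ℝ), κ) (ε κ) →
      (0, k) ∈ ball ((0 : ℝ), κ') (ε κ') → F κ =ᶠ[𝓝 (0, k)] F κ') :
    ∃ (U : Set (ℝ × ℝ)) (g : ℝ × ℝ → ℝ), IsOpen U ∧ (∀ k, 0 < k → (0, k) ∈ U) ∧
      (∀ p ∈ U, ∃ κ, 0 < κ ∧ p ∈ ball (0, κ) (ε κ)) ∧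
      ∀ κ, 0 < κ → EqOn g (F κ) (ball (0, κ) (ε κ)) := by
  classical
  -- overlapping balls of the sup metric centred on the axis meet on the axis
  have hagree : ∀ κ κ' p, 0 < κ → 0 < κ' → p ∈ ball ((0 : ℝ), κ) (ε κ) →
      p ∈ ball ((0 : ℝ), κ') (ε κ') → F κ p = F κ' p := by
    intro κ κ' p h h' hp hp'
    have hax : ∀ τ, p ∈ ball ((0 : ℝ), τ) (ε τ) → ((0 : ℝ), p.2) ∈ ball ((0 : ℝ), τ) (ε τ) := by
      intro τ hτ
      rw [mem_ball, Prod.dist_eq] at hτ ⊢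
      refine lt_of_le_of_lt (max_le ?_ (le_max_right _ _)) hτ
      simp
    refine AnalyticOnNhd.eqOn_of_preconnected_of_eventuallyEq
      (U := ball ((0 : ℝ), κ) (ε κ) ∩ ball ((0 : ℝ), κ') (ε κ'))
      ((hF κ h).mono inter_subset_left) ((hF κ' h').mono inter_subset_right)
      ((convex_ball _ _).inter (convex_ball _ _)).isPreconnected ⟨hax κ hp, hax κ' hp'⟩
      (hc κ κ' p.2 h h' (hax κ hp) (hax κ' hp')) ⟨hp, hp'⟩
  let U : Set (ℝ × ℝ) := ⋃ κ ∈ Ioi (0 : ℝ), ball (0, κ) (ε κ)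
  have hU : ∀ p ∈ U, ∃ κ, 0 < κ ∧ p ∈ ball ((0 : ℝ), κ) (ε κ) := by
    intro p hp
    simpa [U] using hp
  refine ⟨U, fun p => if h : p ∈ U then F (hU p h).choose p else 0,
    isOpen_biUnion fun _ _ => isOpen_ball, fun k hk => ?_, hU, fun κ hκ p hp => ?_⟩
  · exact mem_biUnion (mem_Ioi.2 hk) (mem_ball_self (hε k hk))
  · have h : p ∈ U := mem_biUnion (mem_Ioi.2 hκ) hp
    simp only [h, dif_pos]
    exact hagree _ _ p (hU p h).choose_spec.1 hκ (hU p h).choose_spec.2 hp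

/-- Implicit function theorem along a half axis: a scalar equation `G (x, k, t) = 0` that is solved
at `x = 0` by `t = τ k` for all `k > 0`, nondegenerately, has a single analytic solution on a tube
around the half axis. The local solutions are glued by the identity theorem. -/
theorem exists_implicit_along_axis {G : (ℝ × ℝ) × ℝ → ℝ} {τ : ℝ → ℝ} {c : ℝ → ℝ}
    {W : Set ((ℝ × ℝ) × ℝ)} (hW : IsOpen W) (hτW : ∀ k, 0 < k → ((0, k), τ k) ∈ W)
    (hτ : ContinuousOn τ (Ioi 0))
    (hG : ∀ k, 0 < k → AnalyticAt ℝ G ((0, k), τ k)) (hG0 : ∀ k, 0 < k → G ((0, k), τ k) = 0)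
    (hc : ∀ k, 0 < k → HasDerivAt (fun t => G ((0, k), t)) (c k) (τ k))
    (hc0 : ∀ k, 0 < k → c k ≠ 0) :
    ∃ (α : ℝ → ℝ) (g : ℝ × ℝ → ℝ), ContinuousOn α (Ioi 0) ∧ (∀ k, 0 < k → 0 < α k) ∧
      AnalyticOnNhd ℝ g (tube α) ∧ (∀ k, 0 < k → g (0, k) = τ k) ∧
      (∀ p ∈ tube α, (p, g p) ∈ W) ∧ (∀ p ∈ tube α, G (p, g p) = 0) ∧
      ∀ k, 0 < k → ∀ᶠ p in 𝓝 (((0 : ℝ), k), τ k), G p = 0 → p.2 = g p.1 := by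
  have hloc : ∀ κ : ℝ, ∃ f : ℝ × ℝ → ℝ, 0 < κ → ∃ ε, 0 < ε ∧ ε ≤ κ ∧
      AnalyticOnNhd ℝ f (ball (0, κ) ε) ∧ (∀ p ∈ ball ((0 : ℝ), κ) ε, G (p, f p) = 0) ∧
      (∀ p ∈ ball ((0 : ℝ), κ) ε, (p, f p) ∈ W) ∧
      (∀ k, (0, k) ∈ ball ((0 : ℝ), κ) ε → f (0, k) = τ k) := by
    intro κ
    by_cases hκ : 0 < κ
    swap
    · exact ⟨fun _ => 0, fun h => absurd h hκ⟩
    obtain ⟨f, hfa, hf0, hfG, hfu⟩ := exists_analyticAt_implicit (hG κ hκ) (hc κ hκ) (hc0 κ hκ)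
    rw [hG0 κ hκ] at hfG hfu
    refine ⟨f, fun _ => ?_⟩
    have hfc : Tendsto (fun p => (p, f p)) (𝓝 (0, κ)) (𝓝 ((0, κ), τ κ)) := by
      have : ContinuousAt (fun p => (p, f p)) (0, κ) := continuousAt_id.prodMk hfa.continuousAt
      simpa [ContinuousAt, hf0] using this
    have h1 : ∀ᶠ p in 𝓝 ((0 : ℝ), κ), (p, f p) ∈ W := hfc.eventually (hW.mem_nhds (hτW κ hκ))
    have h2 : ∀ᶠ k in 𝓝 κ, τ k = f (0, k) := by
      have hτc : ContinuousAt τ κ := hτ.continuousAt (Ioi_mem_nhds hκ)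
      have h3 : Tendsto (fun k : ℝ => (((0 : ℝ), k), τ k)) (𝓝 κ) (𝓝 ((0, κ), τ κ)) := by
        have : ContinuousAt (fun k : ℝ => (((0 : ℝ), k), τ k)) κ :=
          (by fun_prop : ContinuousAt (fun k : ℝ => ((0 : ℝ), k)) κ).prodMk hτc
        exact this
      filter_upwards [h3.eventually hfu, Ioi_mem_nhds hκ] with k hk hk0
      exact hk (hG0 k hk0)
    have h2' : ∀ᶠ p in 𝓝 ((0 : ℝ), κ), τ p.2 = f (0, p.2) :=
      (continuous_snd.tendsto ((0 : ℝ), κ)).eventually h2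
    obtain ⟨ε, hε, hball⟩ := Metric.eventually_nhds_iff_ball.1
      (hfa.eventually_analyticAt.and (hfG.and (h1.and h2')))
    refine ⟨min ε κ, lt_min hε hκ, min_le_right _ _, ?_, ?_, ?_, ?_⟩
    · exact fun p hp => (hball p (ball_subset_ball (min_le_left _ _) hp)).1
    · exact fun p hp => (hball p (ball_subset_ball (min_le_left _ _) hp)).2.1
    · exact fun p hp => (hball p (ball_subset_ball (min_le_left _ _) hp)).2.2.1
    · exact fun k hk => ((hball _ (ball_subset_ball (min_le_left _ _) hk)).2.2.2).symm
  choose F hF using hloc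
  have hpos : ∀ κ : ℝ, ∃ ε, 0 < κ → 0 < ε ∧ ε ≤ κ ∧
      AnalyticOnNhd ℝ (F κ) (ball (0, κ) ε) ∧ (∀ p ∈ ball ((0 : ℝ), κ) ε, G (p, F κ p) = 0) ∧
      (∀ p ∈ ball ((0 : ℝ), κ) ε, (p, F κ p) ∈ W) ∧
      (∀ k, (0, k) ∈ ball ((0 : ℝ), κ) ε → F κ (0, k) = τ k) := by
    intro κ
    by_cases hκ : 0 < κ
    · obtain ⟨ε, h⟩ := hF κ hκ
      exact ⟨ε, fun _ => h⟩
    · exact ⟨0, fun h => absurd h hκ⟩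
  choose ε hε using hpos
  have hkpos : ∀ κ, 0 < κ → ∀ p ∈ ball ((0 : ℝ), κ) (ε κ), 0 < p.2 := by
    intro κ hκ p hp
    rw [mem_ball, Prod.dist_eq] at hp
    have h1 : |p.2 - κ| < ε κ := lt_of_le_of_lt (le_max_right _ _) hp
    have h2 := (hε κ hκ).2.1
    linarith [(abs_lt.1 h1).1]
  have huniq : ∀ κ k, 0 < κ → (0, k) ∈ ball ((0 : ℝ), κ) (ε κ) →
      ∀ᶠ p in 𝓝 (((0 : ℝ), k), τ k), G p = 0 → p.2 = F κ p.1 := by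
    intro κ k hκ hk
    have hk0 : 0 < k := hkpos κ hκ _ hk
    obtain ⟨f, hfa, hf0, hfG, hfu⟩ := exists_analyticAt_implicit (hG k hk0) (hc k hk0) (hc0 k hk0)
    rw [hG0 k hk0] at hfu
    obtain ⟨-, -, han, hz, -, hax⟩ := hε κ hκ
    have hFc : Tendsto (fun p => (p, F κ p)) (𝓝 (0, k)) (𝓝 ((0, k), τ k)) := by
      have : ContinuousAt (fun p => (p, F κ p)) (0, k) :=
        continuousAt_id.prodMk (han _ hk).continuousAt
      simpa [ContinuousAt, hax k hk] using this
    have h1 : ∀ᶠ p in 𝓝 ((0 : ℝ), k), F κ p = f p := by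
      filter_upwards [hFc.eventually hfu, isOpen_ball.mem_nhds hk] with p hp hpb
      exact hp (hz p hpb)
    have h2 : ∀ᶠ p in 𝓝 (((0 : ℝ), k), τ k), F κ p.1 = f p.1 :=
      (continuous_fst.tendsto (((0 : ℝ), k), τ k)).eventually h1
    filter_upwards [hfu, h2] with p hp hp2 h
    rw [hp h, hp2]
  obtain ⟨U, g, hUo, hU0, hUb, hg⟩ := exists_analyticOnNhd_glue (F := F) (ε := ε)
    (fun κ hκ => (hε κ hκ).1) (fun κ hκ => (hε κ hκ).2.2.1) (by
      intro κ κ' k hκ hκ' hk hk'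
      obtain ⟨-, -, han, hz, -, hax⟩ := hε κ hκ
      have hFc : Tendsto (fun p => (p, F κ p)) (𝓝 (0, k)) (𝓝 ((0, k), τ k)) := by
        have : ContinuousAt (fun p => (p, F κ p)) (0, k) :=
          continuousAt_id.prodMk (han _ hk).continuousAt
        simpa [ContinuousAt, hax k hk] using this
      filter_upwards [hFc.eventually (huniq κ' k hκ' hk'), isOpen_ball.mem_nhds hk] with p hp hpb
      exact hp (hz p hpb))
  have hself : ∀ k, 0 < k → ((0 : ℝ), k) ∈ ball ((0 : ℝ), k) (ε k) := fun k hk =>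
    mem_ball_self (hε k hk).1
  obtain ⟨α, hαc, hα0, hαU⟩ := exists_tube_subset hUo hU0
  refine ⟨α, g, hαc, hα0, fun p hp => ?_, fun k hk => ?_, fun p hp => ?_, fun p hp => ?_,
    fun k hk => ?_⟩
  · obtain ⟨κ, hκ, hpκ⟩ := hUb p (hαU hp)
    exact ((hε κ hκ).2.2.1 p hpκ).congr
      ((hg κ hκ).symm.eventuallyEq_of_mem (isOpen_ball.mem_nhds hpκ))
  · rw [hg k hk (hself k hk)]
    exact (hε k hk).2.2.2.2.2 k (hself k hk)
  · obtain ⟨κ, hκ, hpκ⟩ := hUb p (hαU hp)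
    rw [hg κ hκ hpκ]
    exact (hε κ hκ).2.2.2.2.1 p hpκ
  · obtain ⟨κ, hκ, hpκ⟩ := hUb p (hαU hp)
    rw [hg κ hκ hpκ]
    exact (hε κ hκ).2.2.2.1 p hpκ
  · have h1 : ∀ᶠ p in 𝓝 ((0 : ℝ), k), g p = F k p :=
      (hg k hk).eventuallyEq_of_mem (isOpen_ball.mem_nhds (hself k hk))
    have h2 : ∀ᶠ p in 𝓝 (((0 : ℝ), k), τ k), g p.1 = F k p.1 :=
      (continuous_fst.tendsto (((0 : ℝ), k), τ k)).eventually h1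
    filter_upwards [huniq k k hk (hself k hk), h2] with p hp hp2 h
    rw [hp h, hp2]

end Axis

/-! ### The potential energy and its normal form -/

section PartialDerivative

/-- The partial derivative in the first variable. -/
def pd (F : ℝ × ℝ → ℝ) (p : ℝ × ℝ) : ℝ := fderiv ℝ F p (1, 0)

theorem hasDerivAt_pd {F : ℝ × ℝ → ℝ} {q m : ℝ} (hF : AnalyticAt ℝ F (q, m)) :
    HasDerivAt (fun x => F (x, m)) (pd F (q, m)) q := by
  have h2 : HasDerivAt (fun x : ℝ => (x, m)) ((1 : ℝ), (0 : ℝ)) q :=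
    (hasDerivAt_id q).prodMk (hasDerivAt_const q m)
  exact hF.differentiableAt.hasFDerivAt.comp_hasDerivAt q h2

theorem analyticOnNhd_pd {F : ℝ × ℝ → ℝ} {U : Set (ℝ × ℝ)} (hF : AnalyticOnNhd ℝ F U) :
    AnalyticOnNhd ℝ (pd F) U :=
  fun p hp => (ContinuousLinearMap.apply ℝ ℝ ((1 : ℝ), (0 : ℝ))).analyticAt _ |>.comp
    (hF.fderiv p hp)

end PartialDerivative

section Force

theorem _root_.AnalyticAt.rpow_const_of_pos {E : Type*} [NormedAddCommGroup E] [NormedSpace ℝ E]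
    {f : E → ℝ} {x : E} (hf : AnalyticAt ℝ f x) (hx : 0 < f x) (e : ℝ) :
    AnalyticAt ℝ (fun y => f y ^ e) x := by
  have h : AnalyticAt ℝ (fun y => Real.exp (Real.log (f y) * e)) x :=
    AnalyticAt.rexp' (f := fun y => Real.log (f y) * e)
      (AnalyticAt.mul (f := fun y => Real.log (f y)) ((analyticAt_log hx).fun_comp hf)
        analyticAt_const)
  refine h.congr ?_
  filter_upwards [hf.continuousAt.eventually (lt_mem_nhds hx)] with y hy
  rw [Real.rpow_def_of_pos hy]

/-- With `v = 1 + s` the rescaled profile and `μ = 1 + m²`, this is `(c - w²) / (c₀ - w₀²)`,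
i.e. `1 - μ (v² - 1) / b`. -/
def gap (b : ℝ) (p : ℝ × ℝ) : ℝ := 1 - (1 + p.2 ^ 2) * ((1 + p.1) ^ 2 - 1) / b

/-- The nonlinearity of the rescaled profile equation `k² s'' = -force b (s, m)`. -/
def force (b : ℝ) (p : ℝ × ℝ) : ℝ := gap b p ^ (-b / 2) - (1 + p.1)

/-- The derivative of `force` in its first argument. -/
def force₁ (b : ℝ) (p : ℝ × ℝ) : ℝ :=
  (1 + p.2 ^ 2) * (1 + p.1) * gap b p ^ (-b / 2 - 1) - 1

/-- The second derivative of `force` in its first argument. -/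
def force₂ (b : ℝ) (p : ℝ × ℝ) : ℝ :=
  (1 + p.2 ^ 2) * gap b p ^ (-b / 2 - 1)
    + (1 + p.2 ^ 2) ^ 2 * ((b + 2) / b) * (1 + p.1) ^ 2 * gap b p ^ (-b / 2 - 2)

/-- The third derivative of `force` in its first argument. -/
def force₃ (b : ℝ) (p : ℝ × ℝ) : ℝ :=
  3 * (1 + p.2 ^ 2) ^ 2 * ((b + 2) / b) * (1 + p.1) * gap b p ^ (-b / 2 - 2)
    + (1 + p.2 ^ 2) ^ 3 * ((b + 2) / b) * ((b + 4) / b) * (1 + p.1) ^ 3 * gap b p ^ (-b / 2 - 3)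

/-- The pairs `(s, m)` such that `gap b` is positive on the segment from `(-s, m)` to `(s, m)`. -/
def safe (b : ℝ) : Set (ℝ × ℝ) := {p | (1 + p.2 ^ 2) * ((1 + |p.1|) ^ 2 - 1) < b}

variable {b : ℝ}

theorem isOpen_safe : IsOpen (safe b) :=
  isOpen_lt (by fun_prop) (by fun_prop)

theorem zero_mem_safe (hb : 0 < b) (m : ℝ) : (0, m) ∈ safe b := by
  simp [safe, hb]

theorem safe_of_abs_le {s t m : ℝ} (h : (s, m) ∈ safe b) (hts : |t| ≤ |s|) : (t, m) ∈ safe b := by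
  simp only [safe, mem_ofPred_eq] at h ⊢
  refine lt_of_le_of_lt ?_ h
  gcongr

theorem gap_pos (hb : 0 < b) {p : ℝ × ℝ} (hp : p ∈ safe b) : 0 < gap b p := by
  simp only [safe, mem_ofPred_eq] at hp
  have h1 : (1 + p.1) ^ 2 ≤ (1 + |p.1|) ^ 2 := by
    nlinarith [le_abs_self p.1, sq_abs p.1]
  have h2 : (1 + p.2 ^ 2) * ((1 + p.1) ^ 2 - 1) < b :=
    lt_of_le_of_lt (by gcongr) hp
  rw [gap, sub_pos, div_lt_one hb]
  exact h2

theorem gap_zero (m : ℝ) : gap b (0, m) = 1 := by simp [gap]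

theorem analyticAt_gap (p : ℝ × ℝ) : AnalyticAt ℝ (gap b) p := by
  unfold gap
  fun_prop

theorem analyticAt_force (hb : 0 < b) {p : ℝ × ℝ} (hp : p ∈ safe b) : AnalyticAt ℝ (force b) p := by
  have := (analyticAt_gap (b := b) p).rpow_const_of_pos (gap_pos hb hp) (-b / 2)
  unfold force
  fun_prop

theorem analyticAt_force₁ (hb : 0 < b) {p : ℝ × ℝ} (hp : p ∈ safe b) :
    AnalyticAt ℝ (force₁ b) p := by
  have := (analyticAt_gap (b := b) p).rpow_const_of_pos (gap_pos hb hp) (-b / 2 - 1)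
  unfold force₁
  fun_prop

theorem hasDerivAt_gap_rpow (hb : 0 < b) {s m : ℝ} (hp : (s, m) ∈ safe b) (e : ℝ) :
    HasDerivAt (fun s => gap b (s, m) ^ e)
      (-(2 * e * (1 + m ^ 2) * (1 + s) / b) * gap b (s, m) ^ (e - 1)) s := by
  have h1 : HasDerivAt (fun s => gap b (s, m)) (-((1 + m ^ 2) * (2 * (1 + s)) / b)) s := by
    have h2 := ((((hasDerivAt_id s).const_add 1).pow 2).sub_const 1).const_mul (1 + m ^ 2)
    have h3 := (h2.div_const b).const_sub 1
    refine HasDerivAt.congr_deriv h3 ?_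
    simp
  refine (h1.rpow_const (p := e) (Or.inl (gap_pos hb hp).ne')).congr_deriv ?_
  ring

theorem hasDerivAt_force (hb : 0 < b) {s m : ℝ} (hp : (s, m) ∈ safe b) :
    HasDerivAt (fun s => force b (s, m)) (force₁ b (s, m)) s := by
  have h := (hasDerivAt_gap_rpow hb hp (-b / 2)).sub ((hasDerivAt_id s).const_add 1)
  refine HasDerivAt.congr_deriv h ?_
  simp only [force₁]
  field_simp

theorem hasDerivAt_force₁ (hb : 0 < b) {s m : ℝ} (hp : (s, m) ∈ safe b) :
    HasDerivAt (fun s => force₁ b (s, m)) (force₂ b (s, m)) s := by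
  have h := ((((hasDerivAt_id s).const_add 1).const_mul (1 + m ^ 2)).mul
    (hasDerivAt_gap_rpow hb hp (-b / 2 - 1))).sub_const 1
  refine HasDerivAt.congr_deriv h ?_
  simp only [force₂, id]
  rw [show -b / 2 - 1 - 1 = -b / 2 - 2 by ring]
  field_simp
  ring

theorem hasDerivAt_force₂ (hb : 0 < b) {s m : ℝ} (hp : (s, m) ∈ safe b) :
    HasDerivAt (fun s => force₂ b (s, m)) (force₃ b (s, m)) s := by
  have h := ((hasDerivAt_gap_rpow hb hp (-b / 2 - 1)).const_mul (1 + m ^ 2)).add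
    (((((hasDerivAt_id s).const_add 1).pow 2).const_mul
      ((1 + m ^ 2) ^ 2 * ((b + 2) / b))).mul (hasDerivAt_gap_rpow hb hp (-b / 2 - 2)))
  refine HasDerivAt.congr_deriv h ?_
  simp only [force₃, id, Pi.pow_apply]
  rw [show -b / 2 - 1 - 1 = -b / 2 - 2 by ring, show -b / 2 - 2 - 1 = -b / 2 - 3 by ring]
  field_simp
  ring

theorem force_zero (m : ℝ) : force b (0, m) = 0 := by simp [force, gap_zero]

theorem force₁_zero (m : ℝ) : force₁ b (0, m) = m ^ 2 := by simp [force₁, gap_zero]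

end Force

section Potential
variable {b : ℝ}

/-- The quotient of the potential energy `∫₀ˢ force` by `s²`. -/
def potentialQuot (b : ℝ) (p : ℝ × ℝ) : ℝ := ∫ t in (0 : ℝ)..1, (1 - t) * force₁ b (t * p.1, p.2)

theorem analyticAt_potentialQuot (hb : 0 < b) {p : ℝ × ℝ} (hp : p ∈ safe b) :
    AnalyticAt ℝ (potentialQuot b) p := by
  refine analyticAt_intervalIntegral
    (f := fun x : (ℝ × ℝ) × ℝ => (1 - x.2) * force₁ b (x.2 * x.1.1, x.1.2)) zero_le_one ?_
  intro t ht
  have hs : (t * p.1, p.2) ∈ safe b := by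
    refine safe_of_abs_le (s := p.1) hp ?_
    rw [abs_mul, abs_of_nonneg ht.1]
    exact mul_le_of_le_one_left (abs_nonneg _) ht.2
  have h1 : AnalyticAt ℝ (fun x : (ℝ × ℝ) × ℝ => force₁ b (x.2 * x.1.1, x.1.2)) (p, t) :=
    AnalyticAt.fun_comp (g := force₁ b) (f := fun x : (ℝ × ℝ) × ℝ => (x.2 * x.1.1, x.1.2))
      (analyticAt_force₁ hb hs) (by fun_prop)
  fun_prop

theorem potentialQuot_zero (m : ℝ) : potentialQuot b (0, m) = m ^ 2 / 2 := by
  simp only [potentialQuot, mul_zero, force₁_zero]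
  rw [intervalIntegral.integral_mul_const, intervalIntegral.integral_sub (by simp) (by simp)]
  simp
  ring

theorem hasDerivAt_integral_force (hb : 0 < b) {s m : ℝ} (hp : (s, m) ∈ safe b) :
    HasDerivAt (fun x => ∫ y in (0 : ℝ)..x, force b (y, m)) (force b (s, m)) s := by
  have hc : ∀ y, (y, m) ∈ safe b → ContinuousAt (fun y => force b (y, m)) y := fun y hy =>
    (hasDerivAt_force hb hy).continuousAt
  have ho : IsOpen {y : ℝ | (y, m) ∈ safe b} := isOpen_safe.preimage (by fun_prop)
  refine intervalIntegral.integral_hasDerivAt_right ?_ ?_ (hc s hp)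
  · refine ContinuousOn.intervalIntegrable (fun y hy => (hc y ?_).continuousWithinAt)
    refine safe_of_abs_le hp ?_
    have := abs_sub_left_of_mem_uIcc hy
    simpa using this
  · exact ContinuousOn.stronglyMeasurableAtFilter ho
      (fun y hy => (hc y hy).continuousWithinAt) s hp

theorem sq_mul_potentialQuot (hb : 0 < b) {s m : ℝ} (hp : (s, m) ∈ safe b) :
    s ^ 2 * potentialQuot b (s, m) = ∫ y in (0 : ℝ)..s, force b (y, m) := by
  have hs : ∀ t ∈ uIcc (0 : ℝ) 1, (t * s, m) ∈ safe b := by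
    intro t ht
    rw [uIcc_of_le zero_le_one] at ht
    refine safe_of_abs_le hp ?_
    rw [abs_mul, abs_of_nonneg ht.1]
    exact mul_le_of_le_one_left (abs_nonneg _) ht.2
  -- integration by parts: the primitive of `(1 - t) s² force₁ (t s)`
  have hd : ∀ t ∈ uIcc (0 : ℝ) 1, HasDerivAt
      (fun t => (1 - t) * s * force b (t * s, m) + ∫ y in (0 : ℝ)..t * s, force b (y, m))
      (s ^ 2 * ((1 - t) * force₁ b (t * s, m))) t := by
    intro t ht
    have h0 : HasDerivAt (fun t : ℝ => t * s) s t := by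
      simpa using (hasDerivAt_id t).mul_const s
    have h1 := (hasDerivAt_force hb (hs t ht)).comp t h0
    have h2 := (hasDerivAt_integral_force hb (hs t ht)).comp t h0
    have h3 := ((((hasDerivAt_id t).const_sub 1).mul_const s).mul h1).add h2
    refine HasDerivAt.congr_deriv h3 ?_
    simp
    ring
  have hi : IntervalIntegrable (fun t => s ^ 2 * ((1 - t) * force₁ b (t * s, m)))
      MeasureTheory.volume 0 1 := by
    refine ContinuousOn.intervalIntegrable (fun t ht => ContinuousAt.continuousWithinAt ?_)
    have h1 : ContinuousAt (fun t : ℝ => force₁ b (t * s, m)) t :=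
      (analyticAt_force₁ hb (hs t ht)).continuousAt.comp (f := fun t : ℝ => (t * s, m))
        (by fun_prop)
    fun_prop
  have h := intervalIntegral.integral_eq_sub_of_hasDerivAt hd hi
  rw [intervalIntegral.integral_const_mul] at h
  rw [potentialQuot, h]
  simp [force_zero]

end Potential

section Profile
variable {b : ℝ}

theorem tube_of_abs_le {ρ : ℝ → ℝ} {q q' m : ℝ} (h : (q, m) ∈ tube ρ) (hq : |q'| ≤ |q|) :
    (q', m) ∈ tube ρ := ⟨h.1, lt_of_le_of_lt hq h.2⟩

/-- In the coordinate `q = S⁻¹(s)` the potential energy `∫₀ˢ force` is exactly `m² q² / 2`. -/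
theorem exists_normalForm (hb : 0 < b) :
    ∃ (ρ : ℝ → ℝ) (S : ℝ × ℝ → ℝ), ContinuousOn ρ (Ioi 0) ∧ (∀ m, 0 < m → 0 < ρ m) ∧
      AnalyticOnNhd ℝ S (tube ρ) ∧ (∀ p ∈ tube ρ, 0 < pd S p) ∧
      (∀ p ∈ tube ρ, (S p, p.2) ∈ safe b) ∧
      (∀ p ∈ tube ρ, p.2 ^ 2 * p.1 = force b (S p, p.2) * pd S p) ∧
      (∀ m, S (0, m) = 0) ∧ (∀ m, 0 < m → pd S (0, m) = 1) := by
  obtain ⟨ρ₀, ψ, hρc, hρ0, hψ, hψ1, hψW, hψG, -⟩ := exists_implicit_along_axis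
    (G := fun x : (ℝ × ℝ) × ℝ => 2 * potentialQuot b (x.1.1 * x.2, x.1.2) * x.2 ^ 2 - x.1.2 ^ 2)
    (τ := fun _ => 1) (c := fun m => 2 * m ^ 2)
    (W := {x : (ℝ × ℝ) × ℝ | (x.1.1 * x.2, x.1.2) ∈ safe b})
    (isOpen_safe.preimage (by fun_prop)) (fun m _ => by simpa using zero_mem_safe hb m)
    continuousOn_const
    (fun m _ => by
      have h1 : AnalyticAt ℝ (fun x : (ℝ × ℝ) × ℝ => potentialQuot b (x.1.1 * x.2, x.1.2))
          ((0, m), 1) :=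
        AnalyticAt.fun_comp (g := potentialQuot b)
          (f := fun x : (ℝ × ℝ) × ℝ => (x.1.1 * x.2, x.1.2))
          (analyticAt_potentialQuot hb (by simpa using zero_mem_safe hb m)) (by fun_prop)
      fun_prop)
    (fun m _ => by simp [potentialQuot_zero]; ring)
    (fun m _ => by
      simp only [zero_mul, potentialQuot_zero]
      have := (((hasDerivAt_id (1 : ℝ)).pow 2).const_mul (2 * (m ^ 2 / 2))).sub_const (m ^ 2)
      refine HasDerivAt.congr_deriv this ?_
      simp
      ring)
    (fun m hm => by positivity)
  let S : ℝ × ℝ → ℝ := fun p => p.1 * ψ p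
  have hS : AnalyticOnNhd ℝ S (tube ρ₀) := analyticOnNhd_fst.mul hψ
  have hpd : AnalyticOnNhd ℝ (pd S) (tube ρ₀) := analyticOnNhd_pd hS
  have hto := isOpen_tube hρc
  have hax : ∀ m, 0 < m → ((0 : ℝ), m) ∈ tube ρ₀ := fun m hm => ⟨hm, by simpa using hρ0 m hm⟩
  have hS1 : ∀ m, 0 < m → pd S (0, m) = 1 := by
    intro m hm
    have h1 := hasDerivAt_pd (hS _ (hax m hm))
    have h2 := (hasDerivAt_id (0 : ℝ)).mul (hasDerivAt_pd (hψ _ (hax m hm)))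
    have h3 := h1.unique h2
    simpa [hψ1 m hm] using h3
  obtain ⟨ρ, hρc', hρ0', hρU⟩ := exists_tube_subset
    (U := tube ρ₀ ∩ pd S ⁻¹' Ioi 0) (hpd.continuousOn.isOpen_inter_preimage hto isOpen_Ioi)
    (fun m hm => ⟨hax m hm, by simp [hS1 m hm]⟩)
  refine ⟨ρ, S, hρc', hρ0', hS.mono fun p hp => (hρU hp).1, fun p hp => (hρU hp).2,
    fun p hp => hψW p (hρU hp).1, ?_, fun m => by simp [S], hS1⟩
  rintro ⟨q, m⟩ hp
  have hq := (hρU hp).1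
  have henergy : ∀ᶠ x in 𝓝 q, 2 * ∫ y in (0 : ℝ)..S (x, m), force b (y, m) = m ^ 2 * x ^ 2 := by
    have hc : ContinuousAt (fun x : ℝ => (x, m)) q := by fun_prop
    filter_upwards [hc.eventually (hto.mem_nhds hq)] with x hx
    rw [← sq_mul_potentialQuot hb (hψW (x, m) hx)]
    have := hψG (x, m) hx
    simp only at this ⊢
    linear_combination x ^ 2 * this
  have h1 := ((hasDerivAt_integral_force hb (hψW (q, m) hq)).comp q
    (hasDerivAt_pd (hS _ hq))).const_mul 2
  have h2 : HasDerivAt (fun x : ℝ => m ^ 2 * x ^ 2) (m ^ 2 * (2 * q)) q := by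
    simpa using (hasDerivAt_pow 2 q).const_mul (m ^ 2)
  have h3 := (h2.congr_of_eventuallyEq henergy).unique h1
  simp only
  linarith

end Profile

/-! ### Action-angle variables -/

/-- Data putting the rescaled profile equation into action-angle form: the amplitude-energy
coordinate `S` on the tube of radius `ρ` around `q = 0`, and the linear frequency `M (r, k)` for
which the orbit of radius `r` has spatial frequency `k`. -/
structure ActionAngle (b : ℝ) where
  /-- radius of the domain of `S` -/
  ρ : ℝ → ℝ
  /-- the displacement `s = S (q, m)` as a function of the normal coordinate `q` -/
  S : ℝ × ℝ → ℝ
  /-- radius of the domain of `M` -/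
  σ : ℝ → ℝ
  /-- the linear frequency of the equilibrium -/
  M : ℝ × ℝ → ℝ
  continuousOn_ρ : ContinuousOn ρ (Ioi 0)
  ρ_pos : ∀ m, 0 < m → 0 < ρ m
  analytic_S : AnalyticOnNhd ℝ S (tube ρ)
  pd_S_pos : ∀ p ∈ tube ρ, 0 < pd S p
  S_mem_safe : ∀ p ∈ tube ρ, (S p, p.2) ∈ safe b
  energy : ∀ p ∈ tube ρ, p.2 ^ 2 * p.1 = force b (S p, p.2) * pd S p
  S_zero : ∀ m, S (0, m) = 0
  pd_S_zero : ∀ m, 0 < m → pd S (0, m) = 1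
  continuousOn_σ : ContinuousOn σ (Ioi 0)
  σ_pos : ∀ k, 0 < k → 0 < σ k
  analytic_M : AnalyticOnNhd ℝ M (tube σ)
  M_mem : ∀ p ∈ tube σ, (p.1, M p) ∈ tube ρ
  M_zero : ∀ k, 0 < k → M (0, k) = k
  M_even : ∀ r k, (r, k) ∈ tube σ → M (-r, k) = M (r, k)
  period : ∀ p ∈ tube σ,
    p.2 * ∫ t in (0 : ℝ)..1, pd S (p.1 * Real.cos (2 * Real.pi * t), M p) = M p

theorem abs_mul_cos_le (r x : ℝ) : |r * Real.cos x| ≤ |r| := by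
  rw [abs_mul]
  exact mul_le_of_le_one_right (abs_nonneg _) (Real.abs_cos_le_one x)

theorem integral_cos_neg {f : ℝ → ℝ} (r : ℝ) :
    ∫ t in (0 : ℝ)..1, f (-r * Real.cos (2 * Real.pi * t))
      = ∫ t in (0 : ℝ)..1, f (r * Real.cos (2 * Real.pi * t)) := by
  have hp : Function.Periodic (fun t => f (r * Real.cos (2 * Real.pi * t))) 1 := by
    intro t
    simp only
    rw [show 2 * Real.pi * (t + 1) = 2 * Real.pi * t + 2 * Real.pi by ring, Real.cos_add_two_pi]
  have h1 : ∀ t : ℝ, f (-r * Real.cos (2 * Real.pi * t))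
      = (fun t => f (r * Real.cos (2 * Real.pi * t))) (t + 1 / 2) := by
    intro t
    simp only
    rw [show 2 * Real.pi * (t + 1 / 2) = 2 * Real.pi * t + Real.pi by ring, Real.cos_add_pi]
    simp
  simp only [h1]
  rw [intervalIntegral.integral_comp_add_right (fun t => f (r * Real.cos (2 * Real.pi * t)))]
  have h2 := hp.intervalIntegral_add_eq (1 / 2) 0
  simp only [zero_add] at h2 ⊢
  rw [← h2]
  norm_num

theorem nonempty_actionAngle {b : ℝ} (hb : 0 < b) : Nonempty (ActionAngle b) := by
  obtain ⟨ρ, S, hρc, hρ0, hS, hpos, hsafe, hen, hS0, hS1⟩ := exists_normalForm hb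
  let A : ℝ × ℝ → ℝ := fun p => ∫ t in (0 : ℝ)..1, pd S (p.1 * Real.cos (2 * Real.pi * t), p.2)
  have hA : AnalyticOnNhd ℝ A (tube ρ) := by
    intro p hp
    refine analyticAt_intervalIntegral
      (f := fun x : (ℝ × ℝ) × ℝ => pd S (x.1.1 * Real.cos (2 * Real.pi * x.2), x.1.2))
      zero_le_one ?_
    intro t _
    refine AnalyticAt.fun_comp (g := pd S)
      (f := fun x : (ℝ × ℝ) × ℝ => (x.1.1 * Real.cos (2 * Real.pi * x.2), x.1.2))
      (analyticOnNhd_pd hS _ (tube_of_abs_le (q := p.1) hp (abs_mul_cos_le _ _))) ?_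
    have : AnalyticAt ℝ (fun x : (ℝ × ℝ) × ℝ => Real.cos (2 * Real.pi * x.2)) (p, t) :=
      Real.analyticAt_cos.fun_comp (f := fun x : (ℝ × ℝ) × ℝ => 2 * Real.pi * x.2) (by fun_prop)
    fun_prop
  have hA0 : ∀ m, 0 < m → A (0, m) = 1 := by
    intro m hm
    simp [A, hS1 m hm]
  have hax : ∀ m, 0 < m → ((0 : ℝ), m) ∈ tube ρ := fun m hm => ⟨hm, by simpa using hρ0 m hm⟩
  obtain ⟨σ, M, hσc, hσ0, hM, hM0, hMW, hMG, hMu⟩ := exists_implicit_along_axis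
    (G := fun x : (ℝ × ℝ) × ℝ => x.1.2 * A (x.1.1, x.2) - x.2) (τ := fun k => k)
    (c := fun _ => -1) (W := {x : (ℝ × ℝ) × ℝ | (x.1.1, x.2) ∈ tube ρ})
    ((isOpen_tube hρc).preimage (by fun_prop)) (fun k hk => hax k hk) continuousOn_id
    (fun k hk => by
      have h1 : AnalyticAt ℝ (fun x : (ℝ × ℝ) × ℝ => A (x.1.1, x.2)) ((0, k), k) :=
        AnalyticAt.fun_comp (g := A) (f := fun x : (ℝ × ℝ) × ℝ => (x.1.1, x.2))
          (hA _ (hax k hk)) (by fun_prop)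
      have h2 : AnalyticAt ℝ (fun x : (ℝ × ℝ) × ℝ => x.1.2) ((0, k), k) := by fun_prop
      exact (h2.mul h1).sub analyticAt_snd)
    (fun k hk => by simp [hA0 k hk])
    (fun k hk => by
      have h1 : (fun m => k * A (0, m) - m) =ᶠ[𝓝 k] fun m => k - m := by
        filter_upwards [Ioi_mem_nhds hk] with m hm
        rw [hA0 m hm, mul_one]
      exact ((hasDerivAt_id k).const_sub k).congr_of_eventuallyEq h1)
    (fun k hk => by norm_num)
  refine ⟨⟨ρ, S, σ, M, hρc, hρ0, hS, hpos, hsafe, hen, hS0, hS1, hσc, hσ0, hM, hMW, hM0, ?_,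
    fun p hp => by linarith [hMG p hp]⟩⟩
  intro r k hrk
  have hk : 0 < k := hrk.1
  have hmem : ∀ x ∈ ball (0 : ℝ) (σ k), (x, k) ∈ tube σ := by
    intro x hx
    exact ⟨hk, by simpa using hx⟩
  have hneg : ∀ x ∈ ball (0 : ℝ) (σ k), -x ∈ ball (0 : ℝ) (σ k) := by
    intro x hx
    simpa using hx
  have hMx : AnalyticOnNhd ℝ (fun x => M (x, k)) (ball 0 (σ k)) := fun x hx =>
    (hM _ (hmem x hx)).fun_comp (f := fun x : ℝ => (x, k)) (analyticAt_id.prod analyticAt_const)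
  have hMx' : AnalyticOnNhd ℝ (fun x => M (-x, k)) (ball 0 (σ k)) := fun x hx =>
    (hMx _ (hneg x hx)).fun_comp (f := fun x : ℝ => -x) analyticAt_id.neg
  have h0 : (0 : ℝ) ∈ ball (0 : ℝ) (σ k) := mem_ball_self (hσ0 k hk)
  refine hMx'.eqOn_of_preconnected_of_eventuallyEq hMx (convex_ball _ _).isPreconnected h0 ?_
    (by simpa using hrk.2)
  -- `M (-x, k)` solves the same equation as `M (x, k)`
  have hlim : Tendsto (fun x : ℝ => ((x, k), M (-x, k))) (𝓝 0) (𝓝 ((0, k), k)) := by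
    have : ContinuousAt (fun x : ℝ => ((x, k), M (-x, k))) 0 :=
      (by fun_prop : ContinuousAt (fun x : ℝ => (x, k)) 0).prodMk (hMx' 0 h0).continuousAt
    simpa [ContinuousAt, hM0 k hk] using this
  filter_upwards [hlim.eventually (hMu k hk), isOpen_ball.mem_nhds h0] with x hx hxb
  refine hx ?_
  have h1 := hMG _ (hmem _ (hneg x hxb))
  simp only [A] at h1 ⊢
  rw [integral_cos_neg (f := fun q => pd S (q, M (-x, k)))] at h1
  exact h1

namespace ActionAngle
variable {b : ℝ} (D : ActionAngle b)

theorem M_pos {p : ℝ × ℝ} (hp : p ∈ tube D.σ) : 0 < D.M p := (D.M_mem p hp).1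

theorem mem_tube {p : ℝ × ℝ} (hp : p ∈ tube D.σ) (θ : ℝ) :
    (p.1 * Real.cos θ, D.M p) ∈ tube D.ρ :=
  tube_of_abs_le (D.M_mem p hp) (abs_mul_cos_le _ _)

/-- The derivative of the phase with respect to the angle, up to the factor `k / M`. -/
def slope (p : ℝ × ℝ) (θ : ℝ) : ℝ := pd D.S (p.1 * Real.cos θ, D.M p)

/-- The phase `z` as a function of the angle `θ` along the orbit with parameters `p = (r, k)`. -/
def phase (p : ℝ × ℝ) (θ : ℝ) : ℝ := p.2 / D.M p * ∫ ϑ in (0 : ℝ)..θ, D.slope p ϑ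

/-- The angle as a function of the phase. -/
def angle (p : ℝ × ℝ) (z : ℝ) : ℝ := Function.invFun (D.phase p) z

variable {p : ℝ × ℝ}

theorem slope_pos (hp : p ∈ tube D.σ) (θ : ℝ) : 0 < D.slope p θ :=
  D.pd_S_pos _ (D.mem_tube hp θ)

theorem continuous_slope (hp : p ∈ tube D.σ) : Continuous (D.slope p) := by
  rw [continuous_iff_continuousAt]
  intro θ
  exact (analyticOnNhd_pd D.analytic_S _ (D.mem_tube hp θ)).continuousAt.comp
    (f := fun θ => (p.1 * Real.cos θ, D.M p)) (by fun_prop)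

theorem hasDerivAt_phase (hp : p ∈ tube D.σ) (θ : ℝ) :
    HasDerivAt (D.phase p) (p.2 / D.M p * D.slope p θ) θ :=
  ((D.continuous_slope hp).integral_hasStrictDerivAt 0 θ).hasDerivAt.const_mul _

theorem strictMono_phase (hp : p ∈ tube D.σ) : StrictMono (D.phase p) := by
  refine strictMono_of_hasDerivAt_pos (fun θ => D.hasDerivAt_phase hp θ) (fun θ => ?_)
  have h1 : 0 < p.2 := hp.1
  have h2 := D.M_pos hp
  have h3 := D.slope_pos hp θ
  positivity

theorem phase_zero : D.phase p 0 = 0 := by simp [phase]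

theorem integral_slope (hp : p ∈ tube D.σ) :
    p.2 / D.M p * ∫ ϑ in (0 : ℝ)..2 * Real.pi, D.slope p ϑ = 2 * Real.pi := by
  have h1 := intervalIntegral.mul_integral_comp_mul_left (a := 0) (b := 1) (f := D.slope p)
    (c := 2 * Real.pi)
  simp only [mul_zero, mul_one] at h1
  have h2 := D.period p hp
  have h3 := (D.M_pos hp).ne'
  rw [← h1]
  simp only [slope]
  field_simp
  exact h2

theorem phase_add_two_pi (hp : p ∈ tube D.σ) (θ : ℝ) :
    D.phase p (θ + 2 * Real.pi) = D.phase p θ + 2 * Real.pi := by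
  have hper : Function.Periodic (D.slope p) (2 * Real.pi) := by
    intro θ
    simp [slope, Real.cos_add_two_pi]
  have hi : ∀ x y, IntervalIntegrable (D.slope p) MeasureTheory.volume x y := fun x y =>
    (D.continuous_slope hp).intervalIntegrable x y
  have h2 := hper.intervalIntegral_add_eq θ 0
  rw [zero_add] at h2
  rw [phase, phase, ← intervalIntegral.integral_add_adjacent_intervals (hi 0 θ) (hi θ _), h2,
    mul_add, D.integral_slope hp]

theorem phase_neg (θ : ℝ) : D.phase p (-θ) = -D.phase p θ := by
  have h : ∫ ϑ in (0 : ℝ)..-θ, D.slope p ϑ = -∫ ϑ in (0 : ℝ)..θ, D.slope p ϑ := by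
    have h1 := intervalIntegral.integral_comp_neg (a := 0) (b := θ) (D.slope p)
    rw [neg_zero] at h1
    rw [intervalIntegral.integral_symm, ← h1]
    simp [slope]
  rw [phase, phase, h, mul_neg]

theorem phase_surjective (hp : p ∈ tube D.σ) : Function.Surjective (D.phase p) := by
  have hc : Continuous (D.phase p) :=
    continuous_iff_continuousAt.2 fun θ => (D.hasDerivAt_phase hp θ).continuousAt
  have hn : ∀ n : ℕ, D.phase p (n * (2 * Real.pi)) = n * (2 * Real.pi) := by
    intro n
    induction n with
    | zero => simp [phase_zero]
    | succ n ih =>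
      have := D.phase_add_two_pi hp (n * (2 * Real.pi))
      push_cast
      rw [add_mul, one_mul, this, ih]
  intro z
  obtain ⟨n, hn'⟩ := exists_nat_ge (|z| / (2 * Real.pi))
  rw [div_le_iff₀ Real.two_pi_pos] at hn'
  have h1 : z ∈ Icc (D.phase p (-(n * (2 * Real.pi)))) (D.phase p (n * (2 * Real.pi))) := by
    rw [D.phase_neg, hn]
    exact abs_le.1 hn'
  have h2 : -((n : ℝ) * (2 * Real.pi)) ≤ n * (2 * Real.pi) := by
    have := Real.two_pi_pos
    have : 0 ≤ (n : ℝ) * (2 * Real.pi) := by positivity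
    linarith
  obtain ⟨θ, -, hθ⟩ := intermediate_value_Icc h2 hc.continuousOn h1
  exact ⟨θ, hθ⟩

theorem phase_angle (hp : p ∈ tube D.σ) (z : ℝ) : D.phase p (D.angle p z) = z :=
  Function.rightInverse_invFun (D.phase_surjective hp) z

theorem angle_phase (hp : p ∈ tube D.σ) (θ : ℝ) : D.angle p (D.phase p θ) = θ :=
  Function.leftInverse_invFun (D.strictMono_phase hp).injective θ

theorem angle_neg (hp : p ∈ tube D.σ) (z : ℝ) : D.angle p (-z) = -D.angle p z := by
  apply (D.strictMono_phase hp).injective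
  rw [D.phase_neg, D.phase_angle hp, D.phase_angle hp]

theorem angle_add_two_pi (hp : p ∈ tube D.σ) (z : ℝ) :
    D.angle p (z + 2 * Real.pi) = D.angle p z + 2 * Real.pi := by
  apply (D.strictMono_phase hp).injective
  rw [D.phase_add_two_pi hp, D.phase_angle hp, D.phase_angle hp]

theorem analyticAt_phase (hp : p ∈ tube D.σ) (θ : ℝ) :
    AnalyticAt ℝ (fun x : (ℝ × ℝ) × ℝ => D.phase x.1 x.2) (p, θ) := by
  have hM : AnalyticAt ℝ (fun x : (ℝ × ℝ) × ℝ => D.M x.1) (p, θ) :=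
    AnalyticAt.fun_comp (g := D.M) (f := fun x : (ℝ × ℝ) × ℝ => x.1) (D.analytic_M p hp)
      analyticAt_fst
  have h1 : AnalyticAt ℝ (fun x : (ℝ × ℝ) × ℝ => ∫ t in (0 : ℝ)..1, D.slope x.1 (t * x.2))
      (p, θ) := by
    refine analyticAt_intervalIntegral
      (f := fun y : ((ℝ × ℝ) × ℝ) × ℝ => D.slope y.1.1 (y.2 * y.1.2)) zero_le_one ?_
    intro t _
    refine AnalyticAt.fun_comp (g := pd D.S)
      (f := fun y : ((ℝ × ℝ) × ℝ) × ℝ => (y.1.1.1 * Real.cos (y.2 * y.1.2), D.M y.1.1))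
      (analyticOnNhd_pd D.analytic_S _ (D.mem_tube hp _)) ?_
    have h2 : AnalyticAt ℝ (fun y : ((ℝ × ℝ) × ℝ) × ℝ => Real.cos (y.2 * y.1.2)) ((p, θ), t) :=
      Real.analyticAt_cos.fun_comp (f := fun y : ((ℝ × ℝ) × ℝ) × ℝ => y.2 * y.1.2) (by fun_prop)
    have h3 : AnalyticAt ℝ (fun y : ((ℝ × ℝ) × ℝ) × ℝ => D.M y.1.1) ((p, θ), t) :=
      AnalyticAt.fun_comp (g := D.M) (f := fun y : ((ℝ × ℝ) × ℝ) × ℝ => y.1.1)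
        (D.analytic_M p hp) (by fun_prop)
    fun_prop
  have h4 : (fun x : (ℝ × ℝ) × ℝ => D.phase x.1 x.2) = fun x : (ℝ × ℝ) × ℝ =>
      x.1.2 / D.M x.1 * (x.2 * ∫ t in (0 : ℝ)..1, D.slope x.1 (t * x.2)) := by
    ext x
    rw [intervalIntegral.mul_integral_comp_mul_right]
    simp [phase]
  rw [h4]
  have h5 := (D.M_pos hp).ne'
  have h6 : AnalyticAt ℝ (fun x : (ℝ × ℝ) × ℝ => x.1.2 / D.M x.1) (p, θ) :=
    AnalyticAt.fun_div (by fun_prop) hM h5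
  fun_prop

theorem analyticAt_angle (hp : p ∈ tube D.σ) (z : ℝ) :
    AnalyticAt ℝ (fun x : (ℝ × ℝ) × ℝ => D.angle x.1 x.2) (p, z) := by
  have h0 := D.phase_angle hp z
  have hG : AnalyticAt ℝ (fun y : ((ℝ × ℝ) × ℝ) × ℝ => D.phase y.1.1 y.2 - y.1.2)
      ((p, z), D.angle p z) := by
    have h1 : AnalyticAt ℝ (fun y : ((ℝ × ℝ) × ℝ) × ℝ => D.phase y.1.1 y.2)
        ((p, z), D.angle p z) :=
      AnalyticAt.fun_comp (g := fun x : (ℝ × ℝ) × ℝ => D.phase x.1 x.2)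
        (f := fun y : ((ℝ × ℝ) × ℝ) × ℝ => (y.1.1, y.2)) (D.analyticAt_phase hp _) (by fun_prop)
    fun_prop
  have hk : 0 < p.2 := hp.1
  obtain ⟨g, hg, -, hgG, -⟩ := exists_analyticAt_implicit hG
    ((D.hasDerivAt_phase hp (D.angle p z)).sub_const z)
    (mul_pos (div_pos hk (D.M_pos hp)) (D.slope_pos hp _)).ne'
  refine hg.congr ?_
  have ho : ∀ᶠ x : (ℝ × ℝ) × ℝ in 𝓝 (p, z), x.1 ∈ tube D.σ :=
    continuous_fst.continuousAt.eventually ((isOpen_tube D.continuousOn_σ).mem_nhds hp)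
  filter_upwards [hgG, ho] with x hx hxt
  have h2 : D.phase x.1 (g x) = x.2 := by linarith
  rw [← D.angle_phase hxt (g x), h2]

theorem hasDerivAt_angle (hp : p ∈ tube D.σ) (z : ℝ) :
    HasDerivAt (D.angle p) (p.2 / D.M p * D.slope p (D.angle p z))⁻¹ z := by
  have hk : 0 < p.2 := hp.1
  have hc : ContinuousAt (D.angle p) z :=
    (D.analyticAt_angle hp z).continuousAt.comp (f := fun z => (p, z)) (by fun_prop)
  exact (D.hasDerivAt_phase hp (D.angle p z)).of_local_left_inverse hc
    (mul_pos (div_pos hk (D.M_pos hp)) (D.slope_pos hp _)).ne'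
    (Eventually.of_forall fun z => D.phase_angle hp z)

end ActionAngle

/-! ### Travelling waves -/

section TravellingWave

/-- A smooth profile satisfying the once integrated travelling-wave equation gives a solution of the
`b`-Novikov equation. -/
theorem isSolution_of_profile {b c d k : ℝ} {w : ℝ → ℝ} (hw : ContDiff ℝ ∞ w)
    (hlt : ∀ z, w z ^ 2 < c)
    (heq : ∀ z, (w z - k ^ 2 * iteratedDeriv 2 w z) * (c - w z ^ 2) ^ (b / 2) = d) :
    IsSolution b (fun x t => w (k * (x - c * t))) := by
  have hd : ∀ n : ℕ, Differentiable ℝ (iteratedDeriv n w) := fun n =>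
    hw.differentiable_iteratedDeriv n (by exact_mod_cast ENat.natCast_lt_top n)
  have hx : ∀ n t, deriv (fun y => iteratedDeriv n w (k * (y - c * t)))
      = fun y => k * iteratedDeriv (n + 1) w (k * (y - c * t)) := by
    intro n t
    ext y
    rw [iteratedDeriv_succ]
    have h1 : HasDerivAt (fun y => k * (y - c * t)) k y := by
      simpa using ((hasDerivAt_id y).sub_const (c * t)).const_mul k
    have h2 := ((hd n).differentiableAt.hasDerivAt (x := k * (y - c * t))).comp y h1
    exact h2.deriv.trans (mul_comm _ _)
  have ht : ∀ n x t, deriv (fun s => iteratedDeriv n w (k * (x - c * s))) t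
      = -(k * c) * iteratedDeriv (n + 1) w (k * (x - c * t)) := by
    intro n x t
    rw [iteratedDeriv_succ]
    have h1 : HasDerivAt (fun s => k * (x - c * s)) (-(k * c)) t := by
      have := (((hasDerivAt_id t).const_mul c).const_sub x).const_mul k
      refine HasDerivAt.congr_deriv this ?_
      ring
    have h2 := ((hd n).differentiableAt.hasDerivAt (x := k * (x - c * t))).comp t h1
    exact h2.deriv.trans (mul_comm _ _)
  have hx1 : ∀ t, deriv (fun y => w (k * (y - c * t)))
      = fun y => k * iteratedDeriv 1 w (k * (y - c * t)) := by
    intro t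
    simpa using hx 0 t
  have hx2 : ∀ t, iteratedDeriv 2 (fun y => w (k * (y - c * t)))
      = fun y => k ^ 2 * iteratedDeriv 2 w (k * (y - c * t)) := by
    intro t
    rw [iteratedDeriv_succ, iteratedDeriv_one, hx1]
    ext y
    rw [deriv_const_mul_field, hx 1]
    ring
  have hx3 : ∀ t, iteratedDeriv 3 (fun y => w (k * (y - c * t)))
      = fun y => k ^ 3 * iteratedDeriv 3 w (k * (y - c * t)) := by
    intro t
    rw [iteratedDeriv_succ, hx2]
    ext y
    rw [deriv_const_mul_field, hx 2]
    ring
  refine ⟨?_, fun x t _ => ?_⟩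
  · have : ContDiff ℝ ∞ (fun p : ℝ × ℝ => w (k * (p.1 - c * p.2))) := hw.comp (by fun_prop)
    exact this.contDiffOn
  have e1 : deriv (fun s => w (k * (x - c * s))) t
      = -(k * c) * iteratedDeriv 1 w (k * (x - c * t)) := by simpa using ht 0 x t
  have e2 : deriv (fun s => iteratedDeriv 2 (fun y => w (k * (y - c * s))) x) t
      = k ^ 2 * (-(k * c) * iteratedDeriv 3 w (k * (x - c * t))) := by
    simp only [hx2]
    rw [deriv_const_mul_field, ht 2]
  rw [e1, e2, hx1, hx2, hx3]
  simp only
  set z := k * (x - c * t) with hz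
  -- differentiate the integrated equation
  have hdz : ∀ n, HasDerivAt (iteratedDeriv n w) (iteratedDeriv (n + 1) w z) z := by
    intro n
    rw [iteratedDeriv_succ]
    exact (hd n).differentiableAt.hasDerivAt
  have h0 : HasDerivAt w (iteratedDeriv 1 w z) z := by simpa using hdz 0
  have hg : 0 < c - w z ^ 2 := sub_pos.2 (hlt z)
  have h1 := (h0.sub ((hdz 2).const_mul (k ^ 2))).mul
    (((h0.pow 2).const_sub c).rpow_const (p := b / 2) (Or.inl hg.ne'))
  have h2 : HasDerivAt (fun _ : ℝ => d) 0 z := hasDerivAt_const z d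
  have h3 := (h2.congr_of_eventuallyEq (Eventually.of_forall heq)).unique h1
  have h4 : (c - w z ^ 2) ^ (b / 2) = (c - w z ^ 2) * (c - w z ^ 2) ^ (b / 2 - 1) := by
    rw [Real.rpow_sub_one hg.ne']
    field_simp
  simp only [Pi.sub_apply, Pi.pow_apply] at h3
  rw [h4] at h3
  have h5 : ((c - w z ^ 2) ^ (b / 2 - 1)) ≠ 0 := (Real.rpow_pos_of_pos hg _).ne'
  have h6 : (c - w z ^ 2) ^ (b / 2 - 1) * ((iteratedDeriv 1 w z - k ^ 2 * iteratedDeriv 3 w z)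
      * (c - w z ^ 2)
      - b * w z * iteratedDeriv 1 w z * (w z - k ^ 2 * iteratedDeriv 2 w z)) = 0 := by
    norm_num at h3
    rw [iteratedDeriv_one]
    linear_combination -h3
  have h7 := (mul_eq_zero.1 h6).resolve_left h5
  linear_combination -k * h7

end TravellingWave

section Equilibrium
variable {b d : ℝ}

theorem w0_pos (hb : 0 < b) (hd : 0 < d) (m : ℝ) : 0 < w0 b d m := by
  unfold w0
  positivity

theorem analyticAt_w0 (hb : 0 < b) (m : ℝ) : AnalyticAt ℝ (w0 b d) m := by
  have h1 : AnalyticAt ℝ (fun m : ℝ => b / (1 + m ^ 2)) m :=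
    analyticAt_const.fun_div (by fun_prop) (by positivity)
  have h2 := h1.rpow_const_of_pos (by positivity) (-b / (2 * (b + 1)))
  exact analyticAt_const.mul h2

theorem analyticAt_c0 (hb : 0 < b) (m : ℝ) : AnalyticAt ℝ (c0 b d) m := by
  have h1 : AnalyticAt ℝ (fun m : ℝ => (m ^ 2 + b + 1) / (m ^ 2 + 1)) m :=
    AnalyticAt.fun_div (by fun_prop) (by fun_prop) (by positivity)
  exact h1.mul ((analyticAt_w0 hb m).pow 2)

theorem c0_pos (hb : 0 < b) (hd : 0 < d) (m : ℝ) : 0 < c0 b d m := by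
  have := w0_pos hb hd m
  unfold c0
  positivity

/-- The equilibrium `w₀` with speed `c₀` has constant of integration `d`. -/
theorem w0_rpow (hb : 0 < b) (hd : 0 < d) (m : ℝ) :
    w0 b d m * (w0 b d m ^ 2 * (b / (1 + m ^ 2))) ^ (b / 2) = d := by
  have h0 := w0_pos hb hd m
  have hβ : 0 < b / (1 + m ^ 2) := by positivity
  have h1 : (w0 b d m ^ 2) ^ (b / 2) = w0 b d m ^ b := by
    rw [← Real.rpow_natCast, ← Real.rpow_mul h0.le]
    congr 1
    push_cast
    ring
  rw [Real.mul_rpow (by positivity) hβ.le, h1, ← mul_assoc]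
  have h2 : w0 b d m * w0 b d m ^ b = w0 b d m ^ (1 + b) := by
    rw [Real.rpow_add h0, Real.rpow_one]
  rw [h2, w0, Real.mul_rpow (by positivity) (by positivity), ← Real.rpow_mul hd.le,
    ← Real.rpow_mul hβ.le, mul_assoc, ← Real.rpow_add hβ]
  have hb1 : b + 1 ≠ 0 := by positivity
  rw [show 1 / (b + 1) * (1 + b) = 1 by field_simp; ring,
    show -b / (2 * (b + 1)) * (1 + b) + b / 2 = 0 by field_simp; ring]
  simp

theorem c0_sub_sq (hb : 0 < b) (m s : ℝ) :
    c0 b d m - (w0 b d m * (1 + s)) ^ 2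
      = w0 b d m ^ 2 * (b / (1 + m ^ 2)) * gap b (s, m) := by
  have h1 : (1 : ℝ) + m ^ 2 ≠ 0 := by positivity
  have h2 : m ^ 2 + (1 : ℝ) ≠ 0 := by positivity
  simp only [c0, gap]
  field_simp
  ring

end Equilibrium

namespace ActionAngle
variable {b : ℝ} (D : ActionAngle b) (d : ℝ)

/-- The wave profile on the orbit of radius `r` and spatial frequency `k`, where `p = (r, k)`. -/
def wave (p : ℝ × ℝ) (z : ℝ) : ℝ :=
  w0 b d (D.M p) * (1 + D.S (p.1 * Real.cos (D.angle p z), D.M p))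

/-- The wave speed on the orbit of radius `r` and spatial frequency `k`, where `p = (r, k)`. -/
def speed (p : ℝ × ℝ) : ℝ := c0 b d (D.M p)

variable {d} {p : ℝ × ℝ}

theorem analyticAt_speed (hb : 0 < b) (hp : p ∈ tube D.σ) : AnalyticAt ℝ (D.speed d) p :=
  (analyticAt_c0 hb _).fun_comp (D.analytic_M p hp)

theorem analyticAt_wave (hb : 0 < b) (hp : p ∈ tube D.σ) (z : ℝ) :
    AnalyticAt ℝ (fun x : (ℝ × ℝ) × ℝ => D.wave d x.1 x.2) (p, z) := by
  have hM : AnalyticAt ℝ (fun x : (ℝ × ℝ) × ℝ => D.M x.1) (p, z) :=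
    AnalyticAt.fun_comp (g := D.M) (f := fun x : (ℝ × ℝ) × ℝ => x.1) (D.analytic_M p hp)
      analyticAt_fst
  have h1 : AnalyticAt ℝ (fun x : (ℝ × ℝ) × ℝ => Real.cos (D.angle x.1 x.2)) (p, z) :=
    Real.analyticAt_cos.fun_comp (D.analyticAt_angle hp z)
  have h2 : AnalyticAt ℝ (fun x : (ℝ × ℝ) × ℝ =>
      D.S (x.1.1 * Real.cos (D.angle x.1 x.2), D.M x.1)) (p, z) :=
    AnalyticAt.fun_comp (g := D.S)
      (f := fun x : (ℝ × ℝ) × ℝ => (x.1.1 * Real.cos (D.angle x.1 x.2), D.M x.1))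
      (D.analytic_S _ (D.mem_tube hp _)) (by fun_prop)
  exact ((analyticAt_w0 hb _).fun_comp hM).mul (analyticAt_const.add h2)

theorem contDiff_wave (hb : 0 < b) (hp : p ∈ tube D.σ) : ContDiff ℝ ∞ (D.wave d p) := by
  have h : AnalyticOnNhd ℝ (D.wave d p) univ := fun z _ =>
    (D.analyticAt_wave hb hp z).fun_comp (f := fun z => (p, z))
      (analyticAt_const.prod analyticAt_id)
  exact (h.contDiff (n := ω)).of_le (by simp)

theorem wave_periodic (hp : p ∈ tube D.σ) : Function.Periodic (D.wave d p) (2 * Real.pi) := by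
  intro z
  simp only [wave]
  rw [D.angle_add_two_pi hp, Real.cos_add_two_pi]

theorem wave_neg (hp : p ∈ tube D.σ) (z : ℝ) : D.wave d p (-z) = D.wave d p z := by
  simp only [wave]
  rw [D.angle_neg hp, Real.cos_neg]

theorem hasDerivAt_wave (hp : p ∈ tube D.σ) (z : ℝ) :
    HasDerivAt (D.wave d p)
      (-(w0 b d (D.M p) * (D.M p / p.2) * p.1 * Real.sin (D.angle p z))) z := by
  have h1 := ((D.hasDerivAt_angle hp z).cos).const_mul p.1
  have h2 := (hasDerivAt_pd (D.analytic_S _ (D.mem_tube hp (D.angle p z)))).comp z h1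
  refine ((h2.const_add 1).const_mul (w0 b d (D.M p))).congr_deriv ?_
  have h3 : pd D.S (p.1 * Real.cos (D.angle p z), D.M p) = D.slope p (D.angle p z) := rfl
  have h4 := (D.slope_pos hp (D.angle p z)).ne'
  have h5 := (D.M_pos hp).ne'
  have h6 : p.2 ≠ 0 := ne_of_gt hp.1
  rw [h3]
  field_simp

theorem sq_mul_iteratedDeriv_wave (hp : p ∈ tube D.σ) (z : ℝ) :
    p.2 ^ 2 * iteratedDeriv 2 (D.wave d p) z = -(w0 b d (D.M p)
      * force b (D.S (p.1 * Real.cos (D.angle p z), D.M p), D.M p)) := by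
  have h0 : deriv (D.wave d p) = fun z =>
      -(w0 b d (D.M p) * (D.M p / p.2) * p.1 * Real.sin (D.angle p z)) :=
    funext fun z => (D.hasDerivAt_wave hp z).deriv
  rw [iteratedDeriv_succ, iteratedDeriv_one, h0]
  have h1 := (((D.hasDerivAt_angle hp z).sin).const_mul
    (w0 b d (D.M p) * (D.M p / p.2) * p.1)).neg
  have h2 := D.energy _ (D.mem_tube hp (D.angle p z))
  have h3 : pd D.S (p.1 * Real.cos (D.angle p z), D.M p) = D.slope p (D.angle p z) := rfl
  have h4 := (D.slope_pos hp (D.angle p z)).ne'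
  have h5 := (D.M_pos hp).ne'
  have h6 : p.2 ≠ 0 := ne_of_gt hp.1
  rw [h3] at h2
  simp only at h2
  have h7 : deriv (fun z => -(w0 b d (D.M p) * (D.M p / p.2) * p.1 * Real.sin (D.angle p z))) z
      = _ := h1.deriv
  rw [h7]
  field_simp
  linear_combination (-w0 b d (D.M p)) * h2

theorem wave_sub (hp : p ∈ tube D.σ) (z : ℝ) :
    D.wave d p z - p.2 ^ 2 * iteratedDeriv 2 (D.wave d p) z = w0 b d (D.M p)
      * gap b (D.S (p.1 * Real.cos (D.angle p z), D.M p), D.M p) ^ (-b / 2) := by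
  rw [D.sq_mul_iteratedDeriv_wave hp, wave, force]
  ring

theorem gap_wave_pos (hb : 0 < b) (hp : p ∈ tube D.σ) (z : ℝ) :
    0 < gap b (D.S (p.1 * Real.cos (D.angle p z), D.M p), D.M p) :=
  gap_pos hb (D.S_mem_safe _ (D.mem_tube hp _))

theorem speed_sub_sq (hb : 0 < b) (z : ℝ) : D.speed d p - D.wave d p z ^ 2
    = w0 b d (D.M p) ^ 2 * (b / (1 + D.M p ^ 2))
      * gap b (D.S (p.1 * Real.cos (D.angle p z), D.M p), D.M p) := c0_sub_sq hb _ _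

theorem wave_sq_lt (hb : 0 < b) (hd : 0 < d) (hp : p ∈ tube D.σ) (z : ℝ) :
    D.wave d p z ^ 2 < D.speed d p := by
  have h1 := D.gap_wave_pos hb hp z
  have h2 := w0_pos hb hd (D.M p)
  rw [← sub_pos, D.speed_sub_sq hb]
  positivity

theorem wave_sub_pos (hb : 0 < b) (hd : 0 < d) (hp : p ∈ tube D.σ) (z : ℝ) :
    0 < D.wave d p z - p.2 ^ 2 * iteratedDeriv 2 (D.wave d p) z := by
  have h1 := D.gap_wave_pos hb hp z
  have h2 := w0_pos hb hd (D.M p)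
  rw [D.wave_sub hp]
  positivity

theorem wave_equation (hb : 0 < b) (hd : 0 < d) (hp : p ∈ tube D.σ) (z : ℝ) :
    (D.wave d p z - p.2 ^ 2 * iteratedDeriv 2 (D.wave d p) z)
      * (D.speed d p - D.wave d p z ^ 2) ^ (b / 2) = d := by
  have h1 := D.gap_wave_pos hb hp z
  have h2 := w0_pos hb hd (D.M p)
  rw [D.wave_sub hp, D.speed_sub_sq hb, Real.mul_rpow (by positivity) h1.le]
  set g := gap b (D.S (p.1 * Real.cos (D.angle p z), D.M p), D.M p)
  have h3 : g ^ (-b / 2) * g ^ (b / 2) = 1 := by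
    rw [← Real.rpow_add h1]
    simp [neg_div]
  have h4 := w0_rpow hb hd (D.M p)
  linear_combination g ^ (-b / 2) * g ^ (b / 2) * h4 + d * h3

end ActionAngle

open Asymptotics

/-! ### Taylor expansion of the normal form -/

section BigO

/-- Integrating a bound in the first variable, uniformly in the second. -/
theorem isBigO_pow_succ_of_hasDerivAt {F F' : ℝ × ℝ → ℝ} {m₀ : ℝ} {n : ℕ}
    (hd : ∀ᶠ p : ℝ × ℝ in 𝓝 (0, m₀), HasDerivAt (fun q => F (q, p.2)) (F' p) p.1)
    (h0 : ∀ᶠ m in 𝓝 m₀, F (0, m) = 0)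
    (hO : F' =O[𝓝 (0, m₀)] fun p => p.1 ^ n) :
    F =O[𝓝 (0, m₀)] fun p => p.1 ^ (n + 1) := by
  obtain ⟨C, hC0, hC⟩ := hO.exists_nonneg
  replace hC := hC.bound
  have h0' : ∀ᶠ p : ℝ × ℝ in 𝓝 (0, m₀), F (0, p.2) = 0 :=
    (continuous_snd.tendsto ((0 : ℝ), m₀)).eventually h0
  obtain ⟨ε, hε, hball⟩ := Metric.eventually_nhds_iff_ball.1 (hd.and (hC.and h0'))
  refine IsBigO.of_bound C ?_
  filter_upwards [ball_mem_nhds _ hε] with p hp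
  obtain ⟨q, m⟩ := p
  have hmem : ∀ x ∈ uIcc 0 q, (x, m) ∈ ball ((0 : ℝ), m₀) ε := by
    intro x hx
    rw [mem_ball, Prod.dist_eq] at hp ⊢
    refine lt_of_le_of_lt (max_le_max ?_ le_rfl) hp
    simpa using abs_sub_left_of_mem_uIcc hx
  have h1 := (convex_uIcc (0 : ℝ) q).norm_image_sub_le_of_norm_hasDerivWithin_le
    (f := fun x => F (x, m)) (f' := fun x => F' (x, m)) (C := C * |q| ^ n)
    (fun x hx => (hball _ (hmem x hx)).1.hasDerivWithinAt)
    (fun x hx => by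
      have h2 := (hball _ (hmem x hx)).2.1
      have h3 : |x| ≤ |q| := by simpa using abs_sub_left_of_mem_uIcc hx
      simp only [norm_pow, Real.norm_eq_abs] at h2 ⊢
      exact h2.trans (by gcongr))
    left_mem_uIcc right_mem_uIcc
  have h4 := (hball _ hp).2.2
  simp only at h4
  simp only [h4, sub_zero, Real.norm_eq_abs, norm_pow] at h1 ⊢
  rw [pow_succ, ← mul_assoc]
  exact h1

end BigO

namespace ActionAngle
variable {b : ℝ} (D : ActionAngle b)

/-- The second derivative of `S (·, m)` at `0`. -/
def β (m : ℝ) : ℝ := pd (pd D.S) (0, m)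

/-- The third derivative of `S (·, m)` at `0`. -/
def γ (m : ℝ) : ℝ := pd (pd (pd D.S)) (0, m)

theorem axis_mem {m : ℝ} (hm : 0 < m) : ((0 : ℝ), m) ∈ tube D.ρ := ⟨hm, by simpa using D.ρ_pos m hm⟩

theorem analytic_pd₁ : AnalyticOnNhd ℝ (pd D.S) (tube D.ρ) := analyticOnNhd_pd D.analytic_S

theorem analytic_pd₂ : AnalyticOnNhd ℝ (pd (pd D.S)) (tube D.ρ) := analyticOnNhd_pd D.analytic_pd₁

theorem analytic_pd₃ : AnalyticOnNhd ℝ (pd (pd (pd D.S))) (tube D.ρ) :=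
  analyticOnNhd_pd D.analytic_pd₂

theorem analyticAt_β {m : ℝ} (hm : 0 < m) : AnalyticAt ℝ D.β m :=
  (D.analytic_pd₂ _ (D.axis_mem hm)).fun_comp (f := fun m => ((0 : ℝ), m))
    (analyticAt_const.prod analyticAt_id)

theorem analyticAt_γ {m : ℝ} (hm : 0 < m) : AnalyticAt ℝ D.γ m :=
  (D.analytic_pd₃ _ (D.axis_mem hm)).fun_comp (f := fun m => ((0 : ℝ), m))
    (analyticAt_const.prod analyticAt_id)

theorem hasDerivAt_unique_of_tube {f g : ℝ × ℝ → ℝ} {f' g' : ℝ} {q m : ℝ}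
    (hp : (q, m) ∈ tube D.ρ) (h : ∀ p ∈ tube D.ρ, f p = g p)
    (hf : HasDerivAt (fun x => f (x, m)) f' q) (hg : HasDerivAt (fun x => g (x, m)) g' q) :
    f' = g' := by
  refine (hf.congr_of_eventuallyEq ?_).unique hg
  have hc : ContinuousAt (fun x : ℝ => (x, m)) q := by fun_prop
  filter_upwards [hc.eventually ((isOpen_tube D.continuousOn_ρ).mem_nhds hp)] with x hx
  exact (h _ hx).symm

/-- The first derivative of the relation `m² q = force (S) S_q` along `q`; the next two follow. They
determine the Taylor coefficients `β` and `γ` of `S`. -/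
theorem energy₂ (hb : 0 < b) : ∀ p ∈ tube D.ρ, p.2 ^ 2
    = force₁ b (D.S p, p.2) * pd D.S p ^ 2 + force b (D.S p, p.2) * pd (pd D.S) p := by
  rintro ⟨q, m⟩ hp
  have hs := D.S_mem_safe _ hp
  have d0 := hasDerivAt_pd (D.analytic_S _ hp)
  have d1 := hasDerivAt_pd (D.analytic_pd₁ _ hp)
  have f0 := (hasDerivAt_force hb hs).comp q d0
  have h1 : HasDerivAt (fun x : ℝ => m ^ 2 * x) (m ^ 2) q := by
    simpa using (hasDerivAt_id q).const_mul (m ^ 2)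
  have h := D.hasDerivAt_unique_of_tube (f := fun p => p.2 ^ 2 * p.1)
    (g := fun p => force b (D.S p, p.2) * pd D.S p) hp D.energy h1 (f0.mul d1)
  simp only [Function.comp_apply] at h
  linear_combination h

theorem energy₃ (hb : 0 < b) : ∀ p ∈ tube D.ρ, 0
    = force₂ b (D.S p, p.2) * pd D.S p ^ 3
      + 3 * force₁ b (D.S p, p.2) * pd D.S p * pd (pd D.S) p
      + force b (D.S p, p.2) * pd (pd (pd D.S)) p := by
  rintro ⟨q, m⟩ hp
  have hs := D.S_mem_safe _ hp
  have d0 := hasDerivAt_pd (D.analytic_S _ hp)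
  have d1 := hasDerivAt_pd (D.analytic_pd₁ _ hp)
  have d2 := hasDerivAt_pd (D.analytic_pd₂ _ hp)
  have f0 := (hasDerivAt_force hb hs).comp q d0
  have f1 := (hasDerivAt_force₁ hb hs).comp q d0
  have h := D.hasDerivAt_unique_of_tube (f := fun p => p.2 ^ 2)
    (g := fun p => force₁ b (D.S p, p.2) * pd D.S p ^ 2 + force b (D.S p, p.2) * pd (pd D.S) p)
    hp (D.energy₂ hb) (hasDerivAt_const q (m ^ 2)) ((f1.mul (d1.pow 2)).add (f0.mul d2))
  simp only [Function.comp_apply, Pi.pow_apply] at h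
  rw [h]
  push_cast
  ring

theorem energy₄ (hb : 0 < b) : ∀ p ∈ tube D.ρ, 0
    = force₃ b (D.S p, p.2) * pd D.S p ^ 4
      + 6 * force₂ b (D.S p, p.2) * pd D.S p ^ 2 * pd (pd D.S) p
      + force₁ b (D.S p, p.2) * (3 * pd (pd D.S) p ^ 2 + 4 * pd D.S p * pd (pd (pd D.S)) p)
      + force b (D.S p, p.2) * pd (pd (pd (pd D.S))) p := by
  rintro ⟨q, m⟩ hp
  have hs := D.S_mem_safe _ hp
  have d0 := hasDerivAt_pd (D.analytic_S _ hp)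
  have d1 := hasDerivAt_pd (D.analytic_pd₁ _ hp)
  have d2 := hasDerivAt_pd (D.analytic_pd₂ _ hp)
  have d3 := hasDerivAt_pd (D.analytic_pd₃ _ hp)
  have f0 := (hasDerivAt_force hb hs).comp q d0
  have f1 := (hasDerivAt_force₁ hb hs).comp q d0
  have f2 := (hasDerivAt_force₂ hb hs).comp q d0
  have h := D.hasDerivAt_unique_of_tube (f := fun _ => 0)
    (g := fun p => force₂ b (D.S p, p.2) * pd D.S p ^ 3
      + 3 * force₁ b (D.S p, p.2) * pd D.S p * pd (pd D.S) p
      + force b (D.S p, p.2) * pd (pd (pd D.S)) p)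
    hp (D.energy₃ hb) (hasDerivAt_const q (0 : ℝ))
    (((f2.mul (d1.pow 3)).add (((f1.const_mul 3).mul d1).mul d2)).add (f0.mul d3))
  simp only [Function.comp_apply, Pi.pow_apply, Pi.mul_apply] at h
  rw [h]
  push_cast
  ring

theorem β_eq (hb : 0 < b) {m : ℝ} (hm : 0 < m) : 3 * m ^ 2 * D.β m = -force₂ b (0, m) := by
  have h := D.energy₃ hb _ (D.axis_mem hm)
  simp only [D.S_zero, D.pd_S_zero m hm, force_zero, force₁_zero] at h
  simp only [β]
  linear_combination -h

theorem γ_eq (hb : 0 < b) {m : ℝ} (hm : 0 < m) :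
    4 * m ^ 2 * D.γ m
      = -(force₃ b (0, m) + 6 * force₂ b (0, m) * D.β m + 3 * m ^ 2 * D.β m ^ 2) := by
  have h := D.energy₄ hb _ (D.axis_mem hm)
  simp only [D.S_zero, D.pd_S_zero m hm, force_zero, force₁_zero] at h
  simp only [β, γ]
  linear_combination -h

section Taylor
variable {k : ℝ}

theorem eventually_tube (hk : 0 < k) : ∀ᶠ p in 𝓝 ((0 : ℝ), k), p ∈ tube D.ρ :=
  (isOpen_tube D.continuousOn_ρ).mem_nhds (D.axis_mem hk)

theorem pd₂_sub_isBigO (hk : 0 < k) :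
    (fun p : ℝ × ℝ => pd (pd D.S) p - D.β p.2) =O[𝓝 (0, k)] fun p => p.1 ^ 1 := by
  refine isBigO_pow_succ_of_hasDerivAt (F' := pd (pd (pd D.S))) (n := 0) ?_ ?_ ?_
  · filter_upwards [D.eventually_tube hk] with p hp
    exact (hasDerivAt_pd (D.analytic_pd₂ _ hp)).sub_const _
  · exact Eventually.of_forall fun m => by simp [β]
  · simpa using (D.analytic_pd₃ _ (D.axis_mem hk)).continuousAt.isBigO_one ℝ

theorem pd₂_sub_isBigO_sq (hk : 0 < k) :
    (fun p : ℝ × ℝ => pd (pd D.S) p - D.β p.2 - D.γ p.2 * p.1) =O[𝓝 (0, k)] fun p => p.1 ^ 2 := by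
  have h1 : (fun p : ℝ × ℝ => pd (pd (pd D.S)) p - D.γ p.2) =O[𝓝 (0, k)] fun p => p.1 ^ 1 := by
    refine isBigO_pow_succ_of_hasDerivAt (F' := pd (pd (pd (pd D.S)))) (n := 0) ?_ ?_ ?_
    · filter_upwards [D.eventually_tube hk] with p hp
      exact (hasDerivAt_pd (D.analytic_pd₃ _ hp)).sub_const _
    · exact Eventually.of_forall fun m => by simp [γ]
    · simpa using (analyticOnNhd_pd D.analytic_pd₃ _ (D.axis_mem hk)).continuousAt.isBigO_one ℝ
  refine isBigO_pow_succ_of_hasDerivAt ?_ ?_ h1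
  · filter_upwards [D.eventually_tube hk] with p hp
    refine (((hasDerivAt_pd (D.analytic_pd₂ _ hp)).sub_const _).sub
      ((hasDerivAt_id p.1).const_mul (D.γ p.2))).congr_deriv ?_
    simp
  · exact Eventually.of_forall fun m => by simp [β]

theorem pd₁_sub_isBigO (hk : 0 < k) :
    (fun p : ℝ × ℝ => pd D.S p - 1 - D.β p.2 * p.1) =O[𝓝 (0, k)] fun p => p.1 ^ 2 := by
  refine isBigO_pow_succ_of_hasDerivAt ?_ ?_ (D.pd₂_sub_isBigO hk)
  · filter_upwards [D.eventually_tube hk] with p hp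
    refine (((hasDerivAt_pd (D.analytic_pd₁ _ hp)).sub_const _).sub
      ((hasDerivAt_id p.1).const_mul (D.β p.2))).congr_deriv ?_
    simp
  · filter_upwards [lt_mem_nhds hk] with m hm
    simp [D.pd_S_zero m hm]

theorem pd₁_sub_isBigO_cube (hk : 0 < k) :
    (fun p : ℝ × ℝ => pd D.S p - 1 - D.β p.2 * p.1 - D.γ p.2 / 2 * p.1 ^ 2)
      =O[𝓝 (0, k)] fun p => p.1 ^ 3 := by
  refine isBigO_pow_succ_of_hasDerivAt ?_ ?_ (D.pd₂_sub_isBigO_sq hk)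
  · filter_upwards [D.eventually_tube hk] with p hp
    refine ((((hasDerivAt_pd (D.analytic_pd₁ _ hp)).sub_const _).sub
      ((hasDerivAt_id p.1).const_mul (D.β p.2))).sub
      ((hasDerivAt_pow 2 p.1).const_mul (D.γ p.2 / 2))).congr_deriv ?_
    simp
    ring
  · filter_upwards [lt_mem_nhds hk] with m hm
    simp [D.pd_S_zero m hm]

theorem S_sub_isBigO (hk : 0 < k) :
    (fun p : ℝ × ℝ => D.S p - p.1 - D.β p.2 / 2 * p.1 ^ 2) =O[𝓝 (0, k)] fun p => p.1 ^ 3 := by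
  refine isBigO_pow_succ_of_hasDerivAt ?_ ?_ (D.pd₁_sub_isBigO hk)
  · filter_upwards [D.eventually_tube hk] with p hp
    refine (((hasDerivAt_pd (D.analytic_S _ hp)).sub (hasDerivAt_id p.1)).sub
      ((hasDerivAt_pow 2 p.1).const_mul (D.β p.2 / 2))).congr_deriv ?_
    simp
    ring
  · exact Eventually.of_forall fun m => by simp [D.S_zero]

end Taylor
end ActionAngle

/-! ### Amplitude dependence of the frequency and of the speed -/

section OneVariable

theorem isBigO_sub_mul_of_analyticAt {f : ℝ → ℝ} {x₀ f' : ℝ} (hf : AnalyticAt ℝ f x₀)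
    (hf' : HasDerivAt f f' x₀) :
    (fun x => f x - f x₀ - f' * (x - x₀)) =O[𝓝 x₀] fun x => (x - x₀) ^ 2 := by
  obtain ⟨p, hp⟩ := hf
  have h := hp.has_fpower_series_dslope_fslope.analyticAt.differentiableAt.isBigO_sub
  rw [dslope_same, hf'.deriv] at h
  refine ((h.mul (isBigO_refl (fun x => x - x₀) (𝓝 x₀))).congr' ?_ ?_)
  · refine Eventually.of_forall fun x => ?_
    have h1 := sub_smul_dslope f x₀ x
    simp only [smul_eq_mul] at h1
    simp only
    linear_combination h1
  · exact Eventually.of_forall fun x => by simp only; ring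

theorem eq_zero_of_isBigO_cube {A B : ℝ}
    (h : (fun r : ℝ => A + B * r ^ 2) =O[𝓝 0] fun r => r ^ 3) : A = 0 ∧ B = 0 := by
  have hA : A = 0 := by
    have := h.eq_zero_imp.self_of_nhds
    simpa using this
  subst hA
  refine ⟨rfl, ?_⟩
  by_contra hB
  have h1 : (fun r : ℝ => 0 + B * r ^ 2) =o[𝓝 0] fun r : ℝ => r ^ 2 :=
    h.trans_isLittleO (isLittleO_pow_pow (by norm_num : 2 < 3))
  have h2 : (fun r : ℝ => r ^ 2) =o[𝓝[≠] 0] fun r : ℝ => r ^ 2 := by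
    refine ((h1.const_mul_left B⁻¹).congr_left fun r => ?_).mono nhdsWithin_le_nhds
    field_simp
    ring
  refine isLittleO_irrefl (Eventually.frequently ?_) h2
  filter_upwards [self_mem_nhdsWithin] with r hr
  exact pow_ne_zero 2 hr

/-- For an even analytic function a cubic remainder is quartic. -/
theorem isBigO_pow_four_of_even {f : ℝ → ℝ} (hf : AnalyticAt ℝ f 0)
    (he : ∀ᶠ r in 𝓝 (0 : ℝ), f (-r) = f r) (h : f =O[𝓝 0] fun r => r ^ 3) :
    f =O[𝓝 0] fun r => r ^ 4 := by
  obtain ⟨p, hp⟩ := hf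
  have h1 := hp.isBigO_sub_partialSum_pow 4
  have hneg : Tendsto (fun r : ℝ => -r) (𝓝 0) (𝓝 0) := by simpa using tendsto_neg (0 : ℝ)
  have h2 := h1.comp_tendsto hneg
  have h3 : (fun r => f r - (p.coeff 0 + p.coeff 2 * r ^ 2)) =O[𝓝 0] fun r => r ^ 4 := by
    have h4 := (h1.add (h2.congr_right (g₂ := fun r : ℝ => ‖r‖ ^ 4) (by simp))).const_mul_left
      (1 / 2)
    refine (h4.congr' ?_ EventuallyEq.rfl).trans
      (IsBigO.of_bound 1 (Eventually.of_forall fun r => by simp))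
    filter_upwards [he] with r hr
    simp only [zero_add, Function.comp_apply, hr, FormalMultilinearSeries.partialSum,
      Finset.sum_range_succ, Finset.sum_range_zero,
      FormalMultilinearSeries.apply_eq_pow_smul_coeff, smul_eq_mul]
    ring
  have h5 : (fun r : ℝ => p.coeff 0 + p.coeff 2 * r ^ 2) =O[𝓝 0] fun r => r ^ 3 := by
    have h6 : (fun r : ℝ => r ^ 4) =O[𝓝 0] fun r : ℝ => r ^ 3 := by
      refine (isLittleO_pow_pow (by norm_num : 3 < 4)).isBigO
    refine (h.sub (h3.trans h6)).congr_left fun r => ?_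
    ring
  obtain ⟨hA, hB⟩ := eq_zero_of_isBigO_cube h5
  simpa [hA, hB] using h3

end OneVariable

namespace ActionAngle
variable {b : ℝ} (D : ActionAngle b) {k : ℝ}

theorem axis_mem_σ (hk : 0 < k) : ((0 : ℝ), k) ∈ tube D.σ := ⟨hk, by simpa using D.σ_pos k hk⟩

theorem eventually_tube_σ (hk : 0 < k) : ∀ᶠ r in 𝓝 (0 : ℝ), (r, k) ∈ tube D.σ :=
  (by fun_prop : ContinuousAt (fun r : ℝ => (r, k)) 0).eventually
    ((isOpen_tube D.continuousOn_σ).mem_nhds (D.axis_mem_σ hk))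

theorem analyticAt_M_radius (hk : 0 < k) : AnalyticAt ℝ (fun r => D.M (r, k)) 0 :=
  (D.analytic_M _ (D.axis_mem_σ hk)).fun_comp (f := fun r : ℝ => (r, k))
    (analyticAt_id.prod analyticAt_const)

theorem tendsto_M (hk : 0 < k) : Tendsto (fun r => D.M (r, k)) (𝓝 0) (𝓝 k) := by
  have := (D.analyticAt_M_radius hk).continuousAt
  simpa [ContinuousAt, D.M_zero k hk] using this

theorem M_sub_isBigO_one (hk : 0 < k) : (fun r => D.M (r, k) - k) =O[𝓝 0] fun r => r := by
  have := (D.analyticAt_M_radius hk).differentiableAt.isBigO_sub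
  simpa [D.M_zero k hk] using this

/-- Along an orbit of small radius `r` the pair `(r cos θ, M)` is close to `(0, k)`, uniformly in
the angle `θ`. -/
theorem eventually_orbit (hk : 0 < k) {P : ℝ × ℝ → Prop} (hP : ∀ᶠ p in 𝓝 (0, k), P p) :
    ∀ᶠ r in 𝓝 (0 : ℝ), ∀ θ : ℝ, P (r * Real.cos θ, D.M (r, k)) := by
  obtain ⟨ε, hε, hball⟩ := Metric.eventually_nhds_iff_ball.1 hP
  filter_upwards [ball_mem_nhds (0 : ℝ) hε, (D.tendsto_M hk).eventually (ball_mem_nhds k hε)]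
    with r hr hM θ
  refine hball _ ?_
  rw [mem_ball, Prod.dist_eq]
  refine max_lt ?_ hM
  simp only [Real.dist_eq, sub_zero]
  refine lt_of_le_of_lt (abs_mul_cos_le r θ) ?_
  simpa using hr

/-- A Taylor bound for a function of `(q, m)` gives a bound along orbits, uniform in the angle. -/
theorem exists_orbit_bound (hk : 0 < k) {F : ℝ × ℝ → ℝ} {n : ℕ}
    (hF : F =O[𝓝 (0, k)] fun p => p.1 ^ n) :
    ∃ C, 0 ≤ C ∧ ∀ᶠ r in 𝓝 (0 : ℝ), ∀ θ, |F (r * Real.cos θ, D.M (r, k))| ≤ C * |r| ^ n := by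
  obtain ⟨C, hC0, hC⟩ := hF.exists_nonneg
  refine ⟨C, hC0, ?_⟩
  filter_upwards [D.eventually_orbit hk hC.bound] with r hr θ
  refine (hr θ).trans ?_
  rw [norm_pow]
  have := abs_mul_cos_le r θ
  simp only [Real.norm_eq_abs]
  gcongr

theorem integral_cos_turn : ∫ t in (0 : ℝ)..1, Real.cos (2 * Real.pi * t) = 0 := by
  rw [intervalIntegral.integral_comp_mul_left (fun x => Real.cos x) Real.two_pi_pos.ne']
  simp

theorem integral_cos_sq_turn : ∫ t in (0 : ℝ)..1, Real.cos (2 * Real.pi * t) ^ 2 = 1 / 2 := by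
  rw [intervalIntegral.integral_comp_mul_left (fun x => Real.cos x ^ 2) Real.two_pi_pos.ne']
  simp
  field_simp

/-- Amplitude dependence of the frequency. -/
theorem M_sub_isBigO (hk : 0 < k) :
    (fun r => D.M (r, k) - (k + k * D.γ k / 4 * r ^ 2)) =O[𝓝 0] fun r => r ^ 3 := by
  obtain ⟨C, hC0, hC⟩ := D.exists_orbit_bound hk (D.pd₁_sub_isBigO_cube hk)
  have h1 : (fun r => D.M (r, k) - (k + k * D.γ (D.M (r, k)) / 4 * r ^ 2))
      =O[𝓝 0] fun r => r ^ 3 := by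
    refine IsBigO.of_bound (k * C) ?_
    filter_upwards [hC, D.eventually_tube_σ hk] with r hr hmem
    set m := D.M (r, k) with hm
    have hper := D.period _ hmem
    simp only at hper
    rw [← hm] at hper
    let R : ℝ → ℝ := fun t => pd D.S (r * Real.cos (2 * Real.pi * t), m) - 1
      - D.β m * (r * Real.cos (2 * Real.pi * t))
      - D.γ m / 2 * (r * Real.cos (2 * Real.pi * t)) ^ 2
    have hcont : Continuous fun t => pd D.S (r * Real.cos (2 * Real.pi * t), m) :=
      (D.continuous_slope hmem).comp (by fun_prop : Continuous fun t : ℝ => 2 * Real.pi * t)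
    have hRc : Continuous R := by
      simp only [R]
      fun_prop
    have hint : ∫ t in (0 : ℝ)..1, pd D.S (r * Real.cos (2 * Real.pi * t), m)
        = (∫ t in (0 : ℝ)..1, R t) + (1 + D.γ m / 4 * r ^ 2) := by
      have hsplit : ∀ t, pd D.S (r * Real.cos (2 * Real.pi * t), m) = R t
          + (1 + D.β m * r * Real.cos (2 * Real.pi * t)
            + D.γ m / 2 * r ^ 2 * Real.cos (2 * Real.pi * t) ^ 2) := fun t => by
        simp only [R]; ring
      simp only [hsplit]
      have hi : ∀ f : ℝ → ℝ, Continuous f → IntervalIntegrable f MeasureTheory.volume 0 1 :=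
        fun f hf => hf.intervalIntegrable 0 1
      rw [intervalIntegral.integral_add (hi _ hRc) (hi _ (by fun_prop)),
        intervalIntegral.integral_add (hi _ (by fun_prop)) (hi _ (by fun_prop)),
        intervalIntegral.integral_add (hi _ (by fun_prop)) (hi _ (by fun_prop)),
        intervalIntegral.integral_const_mul, intervalIntegral.integral_const_mul,
        integral_cos_turn, integral_cos_sq_turn]
      simp
      ring
    have hb : |∫ t in (0 : ℝ)..1, R t| ≤ C * |r| ^ 3 := by
      have := intervalIntegral.norm_integral_le_of_norm_le_const (a := (0 : ℝ)) (b := 1) (f := R)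
        (C := C * |r| ^ 3) (fun t _ => hr (2 * Real.pi * t))
      simpa using this
    rw [hint] at hper
    have : m - (k + k * D.γ m / 4 * r ^ 2) = k * ∫ t in (0 : ℝ)..1, R t := by linarith
    rw [this, norm_mul, Real.norm_eq_abs, Real.norm_eq_abs, abs_of_pos hk, mul_assoc]
    simp only [norm_pow, Real.norm_eq_abs]
    gcongr
  have h2 : (fun r => D.γ (D.M (r, k)) - D.γ k) =O[𝓝 0] fun r => r :=
    ((D.analyticAt_γ hk).differentiableAt.isBigO_sub.comp_tendsto (D.tendsto_M hk)).trans
      (D.M_sub_isBigO_one hk)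
  have h3 := (h2.mul (isBigO_refl (fun r : ℝ => r ^ 2) (𝓝 0))).const_mul_left (k / 4)
  refine (h1.add (h3.trans (isBigO_of_le _ fun r => ?_))).congr_left fun r => ?_
  · rw [← pow_succ']
  · ring

theorem M_sub_isBigO_sq (hk : 0 < k) : (fun r => D.M (r, k) - k) =O[𝓝 0] fun r => r ^ 2 := by
  have h1 : (fun r : ℝ => r ^ 3) =O[𝓝 0] fun r : ℝ => r ^ 2 :=
    (isLittleO_pow_pow (by norm_num : 2 < 3)).isBigO
  refine (((D.M_sub_isBigO hk).trans h1).add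
    ((isBigO_refl (fun r : ℝ => r ^ 2) (𝓝 0)).const_mul_left (k * D.γ k / 4))).congr_left fun r => ?_
  ring

/-- Expansion in the orbit radius of a function of the frequency, used for `w₀` and `c₀`. -/
theorem comp_M_isBigO (hk : 0 < k) {f : ℝ → ℝ} {f' : ℝ} (hf : AnalyticAt ℝ f k)
    (hf' : HasDerivAt f f' k) :
    (fun r => f (D.M (r, k)) - (f k + f' * (k * D.γ k / 4) * r ^ 2)) =O[𝓝 0] fun r => r ^ 3 := by
  have h1 := (isBigO_sub_mul_of_analyticAt hf hf').comp_tendsto (D.tendsto_M hk)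
  have h2 : (fun r => (D.M (r, k) - k) ^ 2) =O[𝓝 0] fun r => r ^ 3 := by
    have h3 := (D.M_sub_isBigO_sq hk).pow 2
    refine h3.trans ?_
    simp only [← pow_mul]
    exact (isLittleO_pow_pow (by norm_num : 3 < 2 * 2)).isBigO
  refine ((h1.trans h2).add ((D.M_sub_isBigO hk).const_mul_left f')).congr_left fun r => ?_
  simp only [Function.comp_apply]
  ring

/-- Expansion of the speed in the orbit radius. -/
theorem speed_isBigO (hb : 0 < b) {d c' : ℝ} (hk : 0 < k) (hc : HasDerivAt (c0 b d) c' k) :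
    (fun r => D.speed d (r, k) - (c0 b d k + c' * (k * D.γ k / 4) * r ^ 2))
      =O[𝓝 0] fun r => r ^ 4 := by
  have ha : AnalyticAt ℝ (fun r => D.speed d (r, k)) 0 :=
    (D.analyticAt_speed hb (D.axis_mem_σ hk)).fun_comp (f := fun r : ℝ => (r, k))
      (analyticAt_id.prod analyticAt_const)
  refine isBigO_pow_four_of_even (ha.sub (by fun_prop)) ?_
    (D.comp_M_isBigO hk (analyticAt_c0 hb k) hc)
  filter_upwards [D.eventually_tube_σ hk] with r hr
  simp [speed, D.M_even r k hr]

end ActionAngle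

/-! ### Expansion of the profile, uniformly over one period -/

section Orders

/-- The filter `r → 0`, uniformly in `z` over one period. -/
def smallRadius : Filter (ℝ × ℝ) := 𝓝 0 ×ˢ 𝓟 (Icc 0 (2 * Real.pi))

variable {f g : ℝ × ℝ → ℝ} {m n : ℕ}

theorem tendsto_fst_smallRadius : Tendsto Prod.fst smallRadius (𝓝 (0 : ℝ)) := tendsto_fst

theorem isBigO_order_mul (hf : f =O[smallRadius] fun x => x.1 ^ m)
    (hg : g =O[smallRadius] fun x => x.1 ^ n) :
    (fun x => f x * g x) =O[smallRadius] fun x => x.1 ^ (m + n) := by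
  simpa only [pow_add] using hf.mul hg

theorem isBigO_order_mono (h : m ≤ n) (hf : f =O[smallRadius] fun x => x.1 ^ n) :
    f =O[smallRadius] fun x => x.1 ^ m := by
  refine hf.trans ?_
  have : (fun r : ℝ => r ^ n) =O[𝓝 0] fun r : ℝ => r ^ m := by
    rcases h.eq_or_lt with rfl | h
    · exact isBigO_refl _ _
    · exact (isLittleO_pow_pow h).isBigO
  exact this.comp_tendsto tendsto_fst_smallRadius

theorem isBigO_order_zero_of_bound {C : ℝ} (h : ∀ x, |f x| ≤ C) :
    f =O[smallRadius] fun x => x.1 ^ 0 :=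
  IsBigO.of_bound C (Eventually.of_forall fun x => by simpa using h x)

theorem isBigO_order_radius : (fun x : ℝ × ℝ => x.1) =O[smallRadius] fun x => x.1 ^ 1 := by
  simpa using isBigO_refl (fun x : ℝ × ℝ => x.1) smallRadius

theorem isBigO_order_of_radius {f : ℝ → ℝ} (h : f =O[𝓝 0] fun r => r ^ n) :
    (fun x : ℝ × ℝ => f x.1) =O[smallRadius] fun x => x.1 ^ n :=
  h.comp_tendsto tendsto_fst_smallRadius

end Orders

namespace ActionAngle
variable {b : ℝ} (D : ActionAngle b) {k : ℝ}

theorem angle_mem_Icc {p : ℝ × ℝ} (hp : p ∈ tube D.σ) {z : ℝ} (hz : z ∈ Icc 0 (2 * Real.pi)) :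
    D.angle p z ∈ Icc 0 (2 * Real.pi) := by
  have hm := D.strictMono_phase hp
  have h1 : D.phase p (2 * Real.pi) = 2 * Real.pi := by
    simpa [D.phase_zero] using D.phase_add_two_pi hp 0
  constructor
  · rw [← hm.le_iff_le, D.phase_zero, D.phase_angle hp]
    exact hz.1
  · rw [← hm.le_iff_le, h1, D.phase_angle hp]
    exact hz.2

/-- The phase `z = (k / M) ∫₀^θ S_q` to second order in the radius; no inversion is needed at this
point, as `θ` stays in one period when `z` does. -/
theorem angle_isBigO (hk : 0 < k) :
    (fun x : ℝ × ℝ => D.M (x.1, k) / k * x.2 - D.angle (x.1, k) x.2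
      - D.β (D.M (x.1, k)) * (x.1 * Real.sin (D.angle (x.1, k) x.2)))
      =O[smallRadius] fun x => x.1 ^ 2 := by
  obtain ⟨C, hC0, hC⟩ := D.exists_orbit_bound hk (D.pd₁_sub_isBigO hk)
  refine IsBigO.of_bound (C * (2 * Real.pi)) ?_
  have h1 : ∀ᶠ x : ℝ × ℝ in smallRadius, x.2 ∈ Icc 0 (2 * Real.pi) :=
    tendsto_snd.eventually (mem_principal_self _)
  filter_upwards [tendsto_fst_smallRadius.eventually hC,
    tendsto_fst_smallRadius.eventually (D.eventually_tube_σ hk), h1]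
  rintro ⟨r, z⟩ hr hmem hz
  simp only at hr hmem hz ⊢
  have hθ := D.angle_mem_Icc hmem hz
  have hphase := D.phase_angle hmem z
  have hm0 := (D.M_pos hmem).ne'
  have hslope := D.continuous_slope hmem
  rw [phase] at hphase
  simp only at hphase
  have hk0 := hk.ne'
  set m := D.M (r, k) with hm
  set θ := D.angle (r, k) z with hθd
  let R : ℝ → ℝ := fun t => D.slope (r, k) t - 1 - D.β m * (r * Real.cos t)
  have hRc : Continuous R := by
    simp only [R]
    fun_prop
  have hint : ∫ t in (0 : ℝ)..θ, D.slope (r, k) t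
      = (∫ t in (0 : ℝ)..θ, R t) + (θ + D.β m * (r * Real.sin θ)) := by
    have hsplit : ∀ t, D.slope (r, k) t = R t + (1 + D.β m * r * Real.cos t) := fun t => by
      simp only [R]; ring
    have hi : ∀ f : ℝ → ℝ, Continuous f → IntervalIntegrable f MeasureTheory.volume 0 θ :=
      fun f hf => hf.intervalIntegrable 0 θ
    rw [intervalIntegral.integral_congr (fun t _ => hsplit t),
      intervalIntegral.integral_add (hi _ hRc) (hi _ (by fun_prop)),
      intervalIntegral.integral_add (hi _ (by fun_prop)) (hi _ (by fun_prop)),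
      intervalIntegral.integral_const_mul]
    simp
    ring
  have hb : |∫ t in (0 : ℝ)..θ, R t| ≤ C * |r| ^ 2 * |θ - 0| :=
    intervalIntegral.norm_integral_le_of_norm_le_const (f := R) (fun t _ => hr t)
  have heq : m / k * z - θ - D.β m * (r * Real.sin θ) = ∫ t in (0 : ℝ)..θ, R t := by
    rw [← hphase, hint]
    field_simp
    ring
  rw [heq, norm_pow, Real.norm_eq_abs, Real.norm_eq_abs]
  refine hb.trans ?_
  rw [sub_zero, abs_of_nonneg hθ.1]
  have := mul_le_mul_of_nonneg_left hθ.2 (by positivity : 0 ≤ C * |r| ^ 2)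
  linarith

theorem β_M_isBigO (hk : 0 < k) :
    (fun x : ℝ × ℝ => D.β (D.M (x.1, k)) - D.β k) =O[smallRadius] fun x => x.1 ^ 1 := by
  refine isBigO_order_of_radius (f := fun r => D.β (D.M (r, k)) - D.β k) ?_
  simpa [Function.comp_def] using
    ((D.analyticAt_β hk).differentiableAt.isBigO_sub.comp_tendsto (D.tendsto_M hk)).trans
      (D.M_sub_isBigO_one hk)

theorem angle_sub_isBigO (hk : 0 < k) :
    (fun x : ℝ × ℝ => D.angle (x.1, k) x.2 - x.2
      + D.β k * x.1 * Real.sin (D.angle (x.1, k) x.2)) =O[smallRadius] fun x => x.1 ^ 2 := by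
  have hz : (fun x : ℝ × ℝ => x.2) =O[smallRadius] fun x => x.1 ^ 0 := by
    refine IsBigO.of_bound (2 * Real.pi) ?_
    have h1 : ∀ᶠ x : ℝ × ℝ in smallRadius, x.2 ∈ Icc 0 (2 * Real.pi) :=
      tendsto_snd.eventually (mem_principal_self _)
    filter_upwards [h1] with x hx
    simpa [abs_of_nonneg hx.1] using hx.2
  have hsin : (fun x : ℝ × ℝ => Real.sin (D.angle (x.1, k) x.2)) =O[smallRadius]
      fun x => x.1 ^ 0 := isBigO_order_zero_of_bound fun x => Real.abs_sin_le_one _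
  have h1 := isBigO_order_mul
    (isBigO_order_of_radius (D.M_sub_isBigO_sq hk) |>.const_mul_left (1 / k)) hz
  have h2 := isBigO_order_mul (isBigO_order_mul (D.β_M_isBigO hk) isBigO_order_radius) hsin
  refine (((D.angle_isBigO hk).neg_left.add h1).sub h2).congr_left fun x => ?_
  field_simp
  ring

theorem angle_sub_isBigO_one (hk : 0 < k) :
    (fun x : ℝ × ℝ => D.angle (x.1, k) x.2 - x.2) =O[smallRadius] fun x => x.1 ^ 1 := by
  have hsin : (fun x : ℝ × ℝ => Real.sin (D.angle (x.1, k) x.2)) =O[smallRadius]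
      fun x => x.1 ^ 0 := isBigO_order_zero_of_bound fun x => Real.abs_sin_le_one _
  have h1 := (isBigO_order_mul isBigO_order_radius hsin).const_mul_left (D.β k)
  refine ((isBigO_order_mono one_le_two (D.angle_sub_isBigO hk)).sub h1).congr_left fun x => ?_
  ring

theorem sin_angle_isBigO (hk : 0 < k) :
    (fun x : ℝ × ℝ => Real.sin (D.angle (x.1, k) x.2) - Real.sin x.2)
      =O[smallRadius] fun x => x.1 ^ 1 := by
  refine (isBigO_of_le _ fun x => ?_).trans (D.angle_sub_isBigO_one hk)
  simpa [Real.dist_eq] using Real.lipschitzWith_sin.dist_le_mul (D.angle (x.1, k) x.2) x.2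

theorem cos_angle_isBigO (hk : 0 < k) :
    (fun x : ℝ × ℝ => Real.cos (D.angle (x.1, k) x.2)
      - (Real.cos x.2 + D.β k * x.1 * Real.sin x.2 ^ 2)) =O[smallRadius] fun x => x.1 ^ 2 := by
  have hsin : (fun x : ℝ × ℝ => Real.sin x.2) =O[smallRadius] fun x => x.1 ^ 0 :=
    isBigO_order_zero_of_bound fun x => Real.abs_sin_le_one _
  have hcos : (fun x : ℝ × ℝ => Real.cos x.2) =O[smallRadius] fun x => x.1 ^ 0 :=
    isBigO_order_zero_of_bound fun x => Real.abs_cos_le_one _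
  have hδ := D.angle_sub_isBigO_one hk
  have hlim : Tendsto (fun x : ℝ × ℝ => D.angle (x.1, k) x.2 - x.2) smallRadius (𝓝 0) := by
    refine hδ.trans_tendsto ?_
    simpa using tendsto_fst_smallRadius
  have hδ2 : (fun x : ℝ × ℝ => (D.angle (x.1, k) x.2 - x.2) ^ 2) =O[smallRadius]
      fun x => x.1 ^ 2 := by
    simpa only [pow_one] using hδ.pow 2
  have hc : (fun x : ℝ × ℝ => Real.cos (D.angle (x.1, k) x.2 - x.2) - 1) =O[smallRadius]
      fun x => x.1 ^ 2 := by
    have h := isBigO_sub_mul_of_analyticAt (Real.analyticAt_cos (x := 0)) (Real.hasDerivAt_cos 0)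
    simp only [Real.cos_zero, Real.sin_zero, neg_zero, zero_mul, sub_zero] at h
    exact (h.comp_tendsto hlim).trans hδ2
  have hs : (fun x : ℝ × ℝ => Real.sin (D.angle (x.1, k) x.2 - x.2)
      - (D.angle (x.1, k) x.2 - x.2)) =O[smallRadius] fun x => x.1 ^ 2 := by
    have h := isBigO_sub_mul_of_analyticAt (Real.analyticAt_sin (x := 0)) (Real.hasDerivAt_sin 0)
    simp only [Real.cos_zero, Real.sin_zero, one_mul, sub_zero] at h
    exact (h.comp_tendsto hlim).trans hδ2
  have h1 := isBigO_order_mul hcos hc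
  have h2 := isBigO_order_mul hsin hs
  have h3 := isBigO_order_mul hsin (D.angle_sub_isBigO hk)
  have h4 := (isBigO_order_mul hsin (isBigO_order_mul isBigO_order_radius
    (D.sin_angle_isBigO hk))).const_mul_left (D.β k)
  refine ((((h1.sub h2).sub h3).add h4).congr_left fun x => ?_)
  have h5 : Real.cos (D.angle (x.1, k) x.2)
      = Real.cos x.2 * Real.cos (D.angle (x.1, k) x.2 - x.2)
        - Real.sin x.2 * Real.sin (D.angle (x.1, k) x.2 - x.2) := by
    rw [← Real.cos_add]
    congr 1
    ring
  rw [h5]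
  ring

/-- Expansion of the rescaled profile in the orbit radius, uniformly over one period. -/
theorem S_orbit_isBigO (hk : 0 < k) :
    (fun x : ℝ × ℝ => D.S (x.1 * Real.cos (D.angle (x.1, k) x.2), D.M (x.1, k))
      - (x.1 * Real.cos x.2 + x.1 ^ 2 * (D.β k * (3 / 4 - Real.cos (2 * x.2) / 4))))
      =O[smallRadius] fun x => x.1 ^ 3 := by
  obtain ⟨C, -, hC⟩ := D.exists_orbit_bound hk (D.S_sub_isBigO hk)
  have h1 : (fun x : ℝ × ℝ => D.S (x.1 * Real.cos (D.angle (x.1, k) x.2), D.M (x.1, k))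
      - x.1 * Real.cos (D.angle (x.1, k) x.2)
      - D.β (D.M (x.1, k)) / 2 * (x.1 * Real.cos (D.angle (x.1, k) x.2)) ^ 2)
      =O[smallRadius] fun x => x.1 ^ 3 := by
    refine IsBigO.of_bound C ?_
    filter_upwards [tendsto_fst_smallRadius.eventually hC] with x hx
    simpa using hx (D.angle (x.1, k) x.2)
  have hr := isBigO_order_radius
  have hr2 := isBigO_order_mul hr hr
  have hcosθ : (fun x : ℝ × ℝ => Real.cos (D.angle (x.1, k) x.2)) =O[smallRadius]
      fun x => x.1 ^ 0 := isBigO_order_zero_of_bound fun x => Real.abs_cos_le_one _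
  have hcos : (fun x : ℝ × ℝ => Real.cos x.2) =O[smallRadius] fun x => x.1 ^ 0 :=
    isBigO_order_zero_of_bound fun x => Real.abs_cos_le_one _
  have hsin2 : (fun x : ℝ × ℝ => Real.sin x.2 ^ 2) =O[smallRadius] fun x => x.1 ^ 0 :=
    isBigO_order_zero_of_bound (C := 1) fun x => by
      rw [abs_of_nonneg (sq_nonneg _)]
      exact Real.sin_sq_le_one _
  have hdiff : (fun x : ℝ × ℝ => Real.cos (D.angle (x.1, k) x.2) - Real.cos x.2) =O[smallRadius]
      fun x => x.1 ^ 1 := by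
    refine ((isBigO_order_mono one_le_two (D.cos_angle_isBigO hk)).add
      ((isBigO_order_mul hr hsin2).const_mul_left (D.β k))).congr_left fun x => ?_
    ring
  have h2 := isBigO_order_mul hr (D.cos_angle_isBigO hk)
  have h3 := (isBigO_order_mul hr2 (isBigO_order_mul hdiff (hcosθ.add hcos))).const_mul_left
    (D.β k / 2)
  have h4 := (isBigO_order_mul (D.β_M_isBigO hk) (isBigO_order_mul hr2
    (isBigO_order_mul hcosθ hcosθ))).const_mul_left (1 / 2)
  refine (((h1.add h2).add h3).add h4).congr_left fun x => ?_
  have h5 := Real.sin_sq_add_cos_sq x.2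
  rw [Real.cos_two_mul]
  linear_combination (-D.β k * x.1 ^ 2) * h5

/-- Expansion of the profile in the orbit radius, uniformly over one period. -/
theorem wave_isBigO (hb : 0 < b) {d w' : ℝ} (hk : 0 < k) (hw : HasDerivAt (w0 b d) w' k) :
    (fun x : ℝ × ℝ => D.wave d (x.1, k) x.2 - (w0 b d k + w0 b d k * x.1 * Real.cos x.2
      + x.1 ^ 2 * (w' * (k * D.γ k / 4)
        + w0 b d k * (D.β k * (3 / 4 - Real.cos (2 * x.2) / 4)))))
      =O[smallRadius] fun x => x.1 ^ 3 := by
  have hW := isBigO_order_of_radius (D.comp_M_isBigO hk (analyticAt_w0 (d := d) hb k) hw)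
  have hS := D.S_orbit_isBigO hk
  have hr := isBigO_order_radius
  have hcos : (fun x : ℝ × ℝ => Real.cos x.2) =O[smallRadius] fun x => x.1 ^ 0 :=
    isBigO_order_zero_of_bound fun x => Real.abs_cos_le_one _
  have hT : (fun x : ℝ × ℝ => D.β k * (3 / 4 - Real.cos (2 * x.2) / 4)) =O[smallRadius]
      fun x => x.1 ^ 0 := by
    refine (isBigO_order_zero_of_bound (C := 1) fun x => ?_).const_mul_left _
    have := abs_le.1 (Real.abs_cos_le_one (2 * x.2))
    rw [abs_le]
    constructor <;> linarith
  -- the displacement itself is of first order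
  have hS1 : (fun x : ℝ × ℝ => D.S (x.1 * Real.cos (D.angle (x.1, k) x.2), D.M (x.1, k)))
      =O[smallRadius] fun x => x.1 ^ 1 := by
    refine (((isBigO_order_mono (by norm_num) hS).add (isBigO_order_mul hr hcos)).add
      (isBigO_order_mono (by norm_num) (isBigO_order_mul (isBigO_order_mul hr hr) hT))).congr_left
      fun x => ?_
    ring
  have hone : (fun _ : ℝ × ℝ => (1 : ℝ)) =O[smallRadius] fun x => x.1 ^ 0 :=
    isBigO_order_zero_of_bound (C := 1) fun x => by simp
  have h1 := isBigO_order_mul hW (hone.add (isBigO_order_mono (Nat.zero_le 1) hS1))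
  have h2 := (isBigO_order_mul (isBigO_order_mul hr hr) hS1).const_mul_left (w' * (k * D.γ k / 4))
  have h3 := hS.const_mul_left (w0 b d k)
  refine ((h1.add h2).add h3).congr_left fun x => ?_
  simp only [wave]
  ring

end ActionAngle

/-! ### The coefficients in terms of the amplitude -/

section Coefficients
variable {b d k : ℝ}

theorem hasDerivAt_w0 (hb : 0 < b) (k : ℝ) :
    HasDerivAt (w0 b d) (w0 b d k * (b * k / ((b + 1) * (1 + k ^ 2)))) k := by
  have hμ : (1 + k ^ 2 : ℝ) ≠ 0 := by positivity
  have hb1 : b + 1 ≠ 0 := by positivity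
  have hβ : 0 < b / (1 + k ^ 2) := by positivity
  have h1 : HasDerivAt (fun m : ℝ => b / (1 + m ^ 2)) (-(b * (2 * k)) / (1 + k ^ 2) ^ 2) k := by
    refine ((hasDerivAt_const k b).div ((hasDerivAt_pow 2 k).const_add 1) hμ).congr_deriv ?_
    simp
  have h2 := (h1.rpow_const (p := -b / (2 * (b + 1))) (Or.inl hβ.ne')).const_mul (d ^ (1 / (b + 1)))
  refine HasDerivAt.congr_deriv h2 ?_
  rw [w0, Real.rpow_sub_one hβ.ne']
  field_simp

theorem hasDerivAt_c0 (hb : 0 < b) (k : ℝ) :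
    HasDerivAt (c0 b d) (w0 b d k ^ 2 * (2 * b * k ^ 3 / ((b + 1) * (1 + k ^ 2) ^ 2))) k := by
  have hμ : (k ^ 2 + 1 : ℝ) ≠ 0 := by positivity
  have h1 : HasDerivAt (fun m : ℝ => (m ^ 2 + b + 1) / (m ^ 2 + 1))
      (-(2 * b * k) / (k ^ 2 + 1) ^ 2) k := by
    refine ((((hasDerivAt_pow 2 k).add_const b).add_const 1).div
      ((hasDerivAt_pow 2 k).add_const 1) hμ).congr_deriv ?_
    simp
    ring
  refine (h1.mul ((hasDerivAt_w0 hb k).pow 2)).congr_deriv ?_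
  simp only [Pi.pow_apply]
  have hb1 : b + 1 ≠ 0 := by positivity
  rw [show (1 + k ^ 2 : ℝ) = k ^ 2 + 1 by ring]
  field_simp
  push_cast
  ring

theorem β_eq_div (D : ActionAngle b) (hb : 0 < b) (hk : 0 < k) :
    D.β k = -((1 + k ^ 2) * (b + (b + 2) * (1 + k ^ 2))) / (3 * b * k ^ 2) := by
  have h := D.β_eq hb hk
  have hk0 := hk.ne'
  simp only [force₂, gap_zero, Real.one_rpow] at h
  rw [eq_div_iff (by positivity)]
  field_simp at h
  linear_combination h

/-- The powers of `b / (1 + k²)` and `d` in `e₁` and `e₂` are those of `1 / w₀`. -/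
theorem w0_inv (hb : 0 < b) (hd : 0 < d) :
    (b / (1 + k ^ 2)) ^ (b / (2 * (1 + b))) / d ^ (1 / (1 + b)) = (w0 b d k)⁻¹ := by
  have hβ : 0 < b / (1 + k ^ 2) := by positivity
  rw [w0, mul_inv, ← Real.rpow_neg hβ.le, add_comm b 1, neg_div, neg_neg]
  field_simp

theorem e2_eq (D : ActionAngle b) (hb : 0 < b) (hd : 0 < d) (hk : 0 < k) :
    e2 b d k = -D.β k / (4 * w0 b d k) := by
  have h0 := w0_pos hb hd k
  have h1 := w0_inv (k := k) hb hd
  rw [β_eq_div D hb hk, e2]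
  have h2 : ((2 + 2 * b) + (4 + 3 * b) * k ^ 2 + (2 + b) * k ^ 4)
      * (b / (1 + k ^ 2)) ^ (b / (2 * (1 + b))) / (12 * b * d ^ (1 / (1 + b)) * k ^ 2)
      = ((2 + 2 * b) + (4 + 3 * b) * k ^ 2 + (2 + b) * k ^ 4) / (12 * b * k ^ 2)
        * ((b / (1 + k ^ 2)) ^ (b / (2 * (1 + b))) / d ^ (1 / (1 + b))) := by
    field_simp
  rw [h2, h1]
  field_simp
  ring

theorem γ_eq_div (D : ActionAngle b) (hb : 0 < b) (hk : 0 < k) :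
    D.γ k = -(3 * (1 + k ^ 2) ^ 2 * ((b + 2) / b) + (1 + k ^ 2) ^ 3 * ((b + 2) / b) * ((b + 4) / b)
      + 6 * ((1 + k ^ 2) + (1 + k ^ 2) ^ 2 * ((b + 2) / b)) * D.β k + 3 * k ^ 2 * D.β k ^ 2)
      / (4 * k ^ 2) := by
  have h := D.γ_eq hb hk
  simp only [force₂, force₃, gap_zero, Real.one_rpow] at h
  rw [eq_div_iff (by positivity)]
  linear_combination h

theorem e1_eq (D : ActionAngle b) (hb : 0 < b) (hd : 0 < d) (hk : 0 < k) :
    e1 b d k = 3 / 4 * D.β k / w0 b d k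
      + b * k ^ 2 / ((b + 1) * (1 + k ^ 2)) * D.γ k / (4 * w0 b d k) := by
  have h0 := w0_pos hb hd k
  have h1 := w0_inv (k := k) hb hd
  have hβ : 0 < b / (1 + k ^ 2) := by positivity
  have h3 : (b / (1 + k ^ 2)) ^ (-(2 + b) / (2 * (1 + b)))
      = (b / (1 + k ^ 2)) ^ (b / (2 * (1 + b))) * ((1 + k ^ 2) / b) := by
    rw [show -(2 + b) / (2 * (1 + b)) = b / (2 * (1 + b)) - 1 by field_simp; ring,
      Real.rpow_sub_one hβ.ne']
    field_simp
  rw [γ_eq_div D hb hk, β_eq_div D hb hk, e1, h3]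
  have h2 : ∀ X Y : ℝ, X * ((b / (1 + k ^ 2)) ^ (b / (2 * (1 + b))) * Y)
      / (24 * (1 + b) * d ^ (1 / (1 + b)) * k ^ 2)
      = X * Y / (24 * (1 + b) * k ^ 2)
        * ((b / (1 + k ^ 2)) ^ (b / (2 * (1 + b))) / d ^ (1 / (1 + b))) := by
    intro X Y
    field_simp
  rw [h2, h1]
  have hb1 : b + 1 ≠ 0 := by positivity
  field_simp
  ring

theorem c2_eq (D : ActionAngle b) (hb : 0 < b) (hk : 0 < k) :
    c2 b k = b * k ^ 4 / (2 * (b + 1) * (1 + k ^ 2) ^ 2) * D.γ k := by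
  rw [γ_eq_div D hb hk, β_eq_div D hb hk, c2]
  have hb1 : b + 1 ≠ 0 := by positivity
  field_simp
  ring

end Coefficients

section Expansions
variable {b d k : ℝ}

theorem tendsto_div_w0 (k : ℝ) : Tendsto (fun a : ℝ => a / w0 b d k) (𝓝 0) (𝓝 0) := by
  simpa using (tendsto_id (x := 𝓝 (0 : ℝ))).div_const (w0 b d k)

theorem speed_expansion (D : ActionAngle b) (hb : 0 < b) (hd : 0 < d) (hk : 0 < k) :
    ∃ C : ℝ, ∀ᶠ a in 𝓝 (0 : ℝ),
      |D.speed d (a / w0 b d k, k) - (c0 b d k + a ^ 2 * c2 b k)| ≤ C * |a| ^ 4 := by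
  obtain ⟨C, hC⟩ := (D.speed_isBigO hb hk (hasDerivAt_c0 (d := d) hb k)).bound
  have h0 := w0_pos hb hd k
  refine ⟨C / w0 b d k ^ 4, ?_⟩
  filter_upwards [(tendsto_div_w0 k).eventually hC] with a ha
  rw [norm_pow, Real.norm_eq_abs, Real.norm_eq_abs, abs_div, abs_of_pos h0, div_pow] at ha
  convert ha using 1
  · congr 3
    rw [c2_eq D hb hk]
    field_simp
    ring
  · field_simp

theorem wave_expansion (D : ActionAngle b) (hb : 0 < b) (hd : 0 < d) (hk : 0 < k) :
    ∃ C : ℝ, ∀ᶠ a in 𝓝 (0 : ℝ), ∀ z : ℝ,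
      |D.wave d (a / w0 b d k, k) z - (w0 b d k + a * Real.cos z
        + a ^ 2 * (e1 b d k + e2 b d k * Real.cos (2 * z)))| ≤ C * |a| ^ 3 := by
  obtain ⟨C, hC⟩ := (D.wave_isBigO hb hk (hasDerivAt_w0 (d := d) hb k)).bound
  have h0 := w0_pos hb hd k
  refine ⟨C / w0 b d k ^ 3, ?_⟩
  rw [smallRadius, eventually_prod_principal_iff] at hC
  filter_upwards [(tendsto_div_w0 k).eventually hC,
    (tendsto_div_w0 k).eventually (D.eventually_tube_σ hk)] with a ha hmem z
  -- both sides are periodic, so it is enough to bound the difference over one period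
  have hper : Function.Periodic (fun z => D.wave d (a / w0 b d k, k) z - (w0 b d k + a * Real.cos z
      + a ^ 2 * (e1 b d k + e2 b d k * Real.cos (2 * z)))) (2 * Real.pi) := by
    intro z
    have h1 : Real.cos (2 * (z + 2 * Real.pi)) = Real.cos (2 * z) := by
      rw [show 2 * (z + 2 * Real.pi) = 2 * z + 2 * Real.pi + 2 * Real.pi by ring,
        Real.cos_add_two_pi, Real.cos_add_two_pi]
    simp only
    rw [D.wave_periodic hmem z, Real.cos_add_two_pi, h1]
  obtain ⟨y, hy, hzy⟩ := hper.exists_mem_Ico₀ Real.two_pi_pos z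
  rw [hzy]
  have ha' := ha y ⟨hy.1, hy.2.le⟩
  rw [norm_pow, Real.norm_eq_abs, Real.norm_eq_abs, abs_div, abs_of_pos h0, div_pow] at ha'
  convert ha' using 1
  · congr 2
    rw [e1_eq D hb hd hk, e2_eq D hb hd hk]
    have hb1 : b + 1 ≠ 0 := by positivity
    field_simp
    ring
  · field_simp

end Expansions

end BNovikov
end

theorem lemma2p1 (b : ℝ) (hb : 0 < b) (d : ℝ) (hd : 0 < d) :
    ∃ (α : ℝ → ℝ) (w : ℝ → ℝ → ℝ → ℝ) (c : ℝ → ℝ → ℝ),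
      ContinuousOn α (Set.Ioi 0) ∧ (∀ k : ℝ, 0 < k → 0 < α k) ∧
      -- real-analytic dependence on the parameters (jointly with `z`, in the case of `w`)
      AnalyticOnNhd ℝ (fun p : ℝ × ℝ × ℝ => w p.1 p.2.1 p.2.2)
        {p : ℝ × ℝ × ℝ | 0 < p.1 ∧ |p.2.1| < α p.1} ∧
      AnalyticOnNhd ℝ (fun p : ℝ × ℝ => c p.1 p.2) {p : ℝ × ℝ | 0 < p.1 ∧ |p.2| < α p.1} ∧
      -- the travelling waves
      (∀ k a : ℝ, 0 < k → |a| < α k →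
        ContDiff ℝ ∞ (w k a) ∧
        Function.Periodic (w k a) (2 * Real.pi) ∧
        (∀ z : ℝ, w k a (-z) = w k a z) ∧
        c k (-a) = c k a ∧
        0 < c k a ∧
        (∀ z : ℝ, w k a z ^ 2 < c k a) ∧
        (∀ z : ℝ, 0 < w k a z - k ^ 2 * iteratedDeriv 2 (w k a) z) ∧
        (∀ z : ℝ, (w k a z - k ^ 2 * iteratedDeriv 2 (w k a) z)
          * (c k a - w k a z ^ 2) ^ (b / 2) = d) ∧
        (∀ t : ℝ, Function.Periodic (fun x : ℝ => w k a (k * (x - c k a * t)))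
          (2 * Real.pi / k)) ∧
        BNovikov.IsSolution b (fun x t => w k a (k * (x - c k a * t)))) ∧
      -- the expansions as `a → 0`, that of `w` uniformly in `z`
      (∀ k : ℝ, 0 < k →
        (∃ C : ℝ, ∀ᶠ a in 𝓝 (0 : ℝ), ∀ z : ℝ,
          |w k a z - (BNovikov.w0 b d k + a * Real.cos z
            + a ^ 2 * (BNovikov.e1 b d k + BNovikov.e2 b d k * Real.cos (2 * z)))|
            ≤ C * |a| ^ 3) ∧
        (∃ C : ℝ, ∀ᶠ a in 𝓝 (0 : ℝ),
          |c k a - (BNovikov.c0 b d k + a ^ 2 * BNovikov.c2 b k)| ≤ C * |a| ^ 4)) := by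
  obtain ⟨D⟩ := BNovikov.nonempty_actionAngle hb
  have hmem : ∀ k a : ℝ, 0 < k → |a| < D.σ k * BNovikov.w0 b d k →
      (a / BNovikov.w0 b d k, k) ∈ BNovikov.tube D.σ := by
    intro k a hk ha
    refine ⟨hk, ?_⟩
    simp only
    rwa [abs_div, abs_of_pos (BNovikov.w0_pos hb hd k), div_lt_iff₀ (BNovikov.w0_pos hb hd k)]
  have han : ∀ p : ℝ × ℝ, AnalyticAt ℝ (fun p : ℝ × ℝ => (p.2 / BNovikov.w0 b d p.1, p.1)) p :=
    fun p =>
    (analyticAt_snd.div ((BNovikov.analyticAt_w0 hb p.1).fun_comp analyticAt_fst)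
      (BNovikov.w0_pos hb hd p.1).ne').prod analyticAt_fst
  -- the orbit radius `r = a / w₀(k)` makes the first harmonic `a cos z` up to third order
  refine ⟨fun k => D.σ k * BNovikov.w0 b d k, fun k a z => D.wave d (a / BNovikov.w0 b d k, k) z,
    fun k a => D.speed d (a / BNovikov.w0 b d k, k), ?_, ?_, ?_, ?_, ?_, ?_⟩
  · exact D.continuousOn_σ.mul fun k _ =>
      (BNovikov.analyticAt_w0 hb k).continuousAt.continuousWithinAt
  · exact fun k hk => mul_pos (D.σ_pos k hk) (BNovikov.w0_pos hb hd k)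
  · rintro ⟨k, a, z⟩ ⟨hk, ha⟩
    refine AnalyticAt.fun_comp (g := fun x : (ℝ × ℝ) × ℝ => D.wave d x.1 x.2)
      (f := fun p : ℝ × ℝ × ℝ => ((p.2.1 / BNovikov.w0 b d p.1, p.1), p.2.2))
      (D.analyticAt_wave hb (hmem k a hk ha) z) ?_
    refine AnalyticAt.prod ?_ (analyticAt_snd.fun_comp analyticAt_snd)
    exact AnalyticAt.fun_comp (g := fun p : ℝ × ℝ => (p.2 / BNovikov.w0 b d p.1, p.1))
      (f := fun p : ℝ × ℝ × ℝ => (p.1, p.2.1)) (han (k, a))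
      (analyticAt_fst.prod (analyticAt_fst.fun_comp analyticAt_snd))
  · rintro ⟨k, a⟩ ⟨hk, ha⟩
    exact AnalyticAt.fun_comp (g := D.speed d)
      (f := fun p : ℝ × ℝ => (p.2 / BNovikov.w0 b d p.1, p.1))
      (D.analyticAt_speed hb (hmem k a hk ha)) (han (k, a))
  · intro k a hk ha
    have hp := hmem k a hk ha
    have hw := D.contDiff_wave (d := d) hb hp
    refine ⟨hw, D.wave_periodic hp, D.wave_neg hp, ?_, BNovikov.c0_pos hb hd _,
      D.wave_sq_lt hb hd hp,
      D.wave_sub_pos hb hd hp, D.wave_equation hb hd hp, ?_,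
      BNovikov.isSolution_of_profile hw (D.wave_sq_lt hb hd hp) (D.wave_equation hb hd hp)⟩
    · simp only [BNovikov.ActionAngle.speed]
      rw [neg_div, D.M_even _ _ hp]
    · intro t x
      simp only
      rw [← D.wave_periodic hp (k * (x - D.speed d (a / BNovikov.w0 b d k, k) * t))]
      congr 1
      field_simp
      ring
  · exact fun k hk => ⟨BNovikov.wave_expansion D hb hd hk, BNovikov.speed_expansion D hb hd hk⟩
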